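/- Let $p$ be a prime and $n\ge 1$. Equip $\mathbb{Q}_p^n$ with $|x|_p=\max_j|x_j|_p$ and with the Haar measure for which the unit ball has measure $1$. For $\gamma\in\mathbb{Z}$ put $B_\gamma(x)=\{y:|y-x|_p\le p^\gamma\}$, $B_\gamma=B_\gamma(0)$, $S_\gamma=\{y:|y|_p=p^\gamma\}$. **Exponents.** Let $\mathfrak{G}$ be the set of measurable $u:\mathbb{Q}_p^n\to[1,\infty)$ with $u_+=\operatorname{ess\,sup}u<\infty$; put $u_-=\operatorname{ess\,inf}u$, and let $u'$ be the conjugate exponent, $1/u(x)+1/u'(x)=1$. Write $u\in W_0^\infty$ if $u\in\mathfrak{G}$ and there is $C>0$ such that $\gamma\,\bigl(\operatorname{ess\,inf}_{B_\gamma(x)}u-\operatorname{ess\,sup}_{B_\gamma(x)}u\bigr)\le C$ for all $x\in\mathbb{Q}_p^n$, $\gamma\in\mathbb{Z}$, and $|u(x)-u(y)|\le C/\log_p\bigl(p+\min\{|x|_p,|y|_p\}\bigr)$ for all $x,y\in\mathbb{Q}_p^n$. **Spaces.** For measurable real-valued $f$ let $\|f\|_{u(\cdot)}=\inf\{s>0:\int|f(x)/s|^{u(x)}dx\le1\}$,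 and let $L^{u(\cdot)}_{\rm loc}$ be the set of $f$ with $\|f\chi_K\|_{u(\cdot)}<\infty$ for every compact $K\subset\mathbb{Q}_p^n$. The Herz space $\dot K^{\beta,m}_{u(\cdot)}$ is the set of $f\in L^{u(\cdot)}_{\rm loc}$ with $$\|f\|_{\dot K^{\beta,m}_{u(\cdot)}}=\Bigl(\sum_{l\in\mathbb{Z}}\|p^{l\beta}f\chi_{S_l}\|_{u(\cdot)}^m\Bigr)^{1/m}<\infty .$$ The space $CMO^{u(\cdot)}$ is the set of $b\in L^{u(\cdot)}_{\rm loc}$ with $$\sup_{\gamma\in\mathbb{Z}}\|\chi_{B_\gamma}\|_{u(\cdot)}^{-1}\,\|(b-b_{B_\gamma})\chi_{B_\gamma}\|_{u(\cdot)}<\infty,\qquad b_{B_\gamma}=\frac1{|B_\gamma|}\int_{B_\gamma}b(x)\,dx .$$ **Operators.** For $x\ne0$ let $$H^p_\alpha f(x)=\frac1{|x|_p^{n-\alpha}}\int_{|t|_p\le|x|_p}f(t)\,dt,\qquad H^{p,*}_\alpha f(x)=\int_{|t|_p>|x|_p}\frac{f(t)}{|t|_p^{n-\alpha}}\,dt,$$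 and $H^p_{\alpha,b}f=bH^p_\alpha f-H^p_\alpha(bf)$, $H^{p,*}_{\alpha,b}f=bH^{p,*}_\alpha f-H^{p,*}_\alpha(bf)$. **Theorem.** Let $0<m_1\le m_2<\infty$, $u\in\mathfrak{G}$ and $\alpha>0$, let $v\in W_0^\infty$ satisfy $\frac1{v(x)}=\frac1{u(x)}-\frac\alpha n$ for all $x$, and suppose $$0<\alpha<\min\Bigl\{\frac n{u_+},\frac n{(v')_+}\Bigr\},\qquad -\frac n{v_+}<\beta<\frac n{(u_-)'},$$ where $(v')_+=\operatorname{ess\,sup}v'$ and $(u_-)'$ is the conjugate of the number $u_-$ (so $u_->1$ and $(u_-)'=\operatorname{ess\,sup}u'$). Let $b\in CMO^{u'(\cdot)}\cap CMO^{v(\cdot)}$. Then for every $f\in\dot K^{\beta,m_1}_{u(\cdot)}$ the integrals defining $H^p_\alpha f$, $H^p_\alpha(bf)$, $H^{p,*}_\alpha f$, $H^{p,*}_\alpha(bf)$ converge absolutely at every $x\neq0$, and both commutators $H^p_{\alpha,b}$ and $H^{p,*}_{\alpha,b}$ map $\dot K^{\beta,m_1}_{u(\cdot)}$ boundedly into $\dot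 K^{\beta,m_2}_{v(\cdot)}$: there is a constant $C$, independent of $f$, such that $$\|H^p_{\alpha,b}f\|_{\dot K^{\beta,m_2}_{v(\cdot)}}\le C\|f\|_{\dot K^{\beta,m_1}_{u(\cdot)}},\qquad \|H^{p,*}_{\alpha,b}f\|_{\dot K^{\beta,m_2}_{v(\cdot)}}\le C\|f\|_{\dot K^{\beta,m_1}_{u(\cdot)}}\qquad\text{for all } f\in\dot K^{\beta,m_1}_{u(\cdot)} .$$ -/

import Mathlib

open MeasureTheory
open scoped ENNReal

noncomputable section

namespace PadicHerz

instance instMeasurableSpacePadic (p : ℕ) [Fact p.Prime] : MeasurableSpace ℚ_[p] := borel _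

instance instBorelSpacePadic (p : ℕ) [Fact p.Prime] : BorelSpace ℚ_[p] := ⟨rfl⟩

/-- The space `ℚ_pⁿ`; its norm is the maximum norm `|x|_p = max_j |x_j|_p`. -/
abbrev Qpn (p : ℕ) [Fact p.Prime] (n : ℕ) : Type := Fin n → ℚ_[p]

variable {p : ℕ} [Fact p.Prime] {n : ℕ}

/-- The ball `B_γ(a) = {x : |x - a|_p ≤ p^γ}`. -/
def ballB (a : Qpn p n) (γ : ℤ) : Set (Qpn p n) := {x | ‖x - a‖ ≤ (p : ℝ) ^ γ}

/-- The sphere `S_γ = {x : |x|_p = p^γ}`, centred at the origin. -/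
def sphereS (p : ℕ) [Fact p.Prime] (n : ℕ) (γ : ℤ) : Set (Qpn p n) := {x | ‖x‖ = (p : ℝ) ^ γ}

/-- The unit ball `B_0`, a compact set with non-empty interior. -/
def unitBall (p : ℕ) [Fact p.Prime] (n : ℕ) : TopologicalSpace.PositiveCompacts (Qpn p n) where
  carrier := Metric.closedBall 0 1
  isCompact' := isCompact_closedBall 0 1
  interior_nonempty' :=
    ⟨0, Metric.ball_subset_interior_closedBall (Metric.mem_ball_self one_pos)⟩

/-- The Haar measure of `ℚ_pⁿ`, normalized so that the unit ball has measure `1`. -/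
def haar (p : ℕ) [Fact p.Prime] (n : ℕ) : Measure (Qpn p n) :=
  Measure.addHaarMeasure (unitBall p n)

/-! Variable exponents -/

/-- `u⁺`, the essential supremum of `u` over `ℚ_pⁿ`. -/
def expSup (u : Qpn p n → ℝ) : ℝ := essSup u (haar p n)

/-- `u⁻`, the essential infimum of `u` over `ℚ_pⁿ`. -/
def expInf (u : Qpn p n → ℝ) : ℝ := essInf u (haar p n)

/-- The class `𝔊(ℚ_pⁿ)`: measurable `u : ℚ_pⁿ → [1, ∞)` with `u⁺ < ∞`. -/
structure IsVarExponent (u : Qpn p n → ℝ) : Prop where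
  measurable : Measurable u
  one_le : ∀ x, 1 ≤ u x
  ess_bdd : ∃ M : ℝ, ∀ᵐ x ∂(haar p n), u x ≤ M

/-- The pointwise conjugate exponent `u'`, where `1 / u x + 1 / u' x = 1`. -/
def conjExp (u : Qpn p n → ℝ) : Qpn p n → ℝ := fun x => Real.conjExponent (u x)

/-- The class `W₀(ℚ_pⁿ)`: `γ (u⁻(B_γ(x)) - u⁺(B_γ(x))) ≤ C` for all `x` and all `γ ∈ ℤ`. -/
def MemW0 (u : Qpn p n → ℝ) : Prop :=
  IsVarExponent u ∧ ∃ C : ℝ, 0 < C ∧ ∀ (x : Qpn p n) (γ : ℤ),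
    (γ : ℝ) * (essInf u ((haar p n).restrict (ballB x γ))
      - essSup u ((haar p n).restrict (ballB x γ))) ≤ C

/-- The class `W^∞(ℚ_pⁿ)`: log-Hölder decay at infinity. -/
def MemWInfty (u : Qpn p n → ℝ) : Prop :=
  IsVarExponent u ∧ ∃ C : ℝ, 0 < C ∧ ∀ x y : Qpn p n,
    |u x - u y| ≤ C * (1 / Real.logb p (p + min ‖y‖ ‖x‖))

/-- `W₀^∞(ℚ_pⁿ) = W₀(ℚ_pⁿ) ∩ W^∞(ℚ_pⁿ)`. -/
def MemW0Infty (u : Qpn p n → ℝ) : Prop := MemW0 u ∧ MemWInfty u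

/-! Lebesgue spaces with variable exponent -/

/-- The modular `∫ |f(x)|^{u(x)} dx`. -/
def modular (u : Qpn p n → ℝ) (f : Qpn p n → ℝ) : ℝ≥0∞ :=
  ∫⁻ x, ENNReal.ofReal (|f x| ^ u x) ∂(haar p n)

/-- The Luxemburg norm `inf {s > 0 : modular (f / s) ≤ 1}`, equal to `∞` if there is no such `s`. -/
def lpNorm (u : Qpn p n → ℝ) (f : Qpn p n → ℝ) : ℝ≥0∞ :=
  sInf (ENNReal.ofReal '' {s : ℝ | 0 < s ∧ modular u (fun x => f x / s) ≤ 1})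

/-- `f ∈ L^{u(·)}(ℚ_pⁿ)`. -/
def MemLpVar (u : Qpn p n → ℝ) (f : Qpn p n → ℝ) : Prop :=
  AEMeasurable f (haar p n) ∧ lpNorm u f < ∞

/-- `f ∈ L^{u(·)}_loc(ℚ_pⁿ)`. -/
def MemLpVarLoc (u : Qpn p n → ℝ) (f : Qpn p n → ℝ) : Prop :=
  ∀ K : Set (Qpn p n), IsCompact K → MemLpVar u (K.indicator f)

/-! Central mean oscillation -/

/-- The mean value `f_{B_γ}` of `f` over `B_γ = B_γ(0)`. -/
def mean (f : Qpn p n → ℝ) (γ : ℤ) : ℝ := ⨍ x in ballB (0 : Qpn p n) γ, f x ∂(haar p n)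

/-- The central mean oscillation
`sup_γ ‖χ_{B_γ}‖⁻¹ ‖(f - f_{B_γ}) χ_{B_γ}‖`, with norms in `L^{u(·)}(ℚ_pⁿ)`. -/
def cmoNorm (u : Qpn p n → ℝ) (f : Qpn p n → ℝ) : ℝ≥0∞ :=
  ⨆ γ : ℤ, (lpNorm u ((ballB (0 : Qpn p n) γ).indicator fun _ => (1 : ℝ)))⁻¹ *
    lpNorm u ((ballB (0 : Qpn p n) γ).indicator fun x => f x - mean f γ)

/-- `f ∈ CMO^{u(·)}(ℚ_pⁿ)`. -/
def MemCMO (u : Qpn p n → ℝ) (f : Qpn p n → ℝ) : Prop :=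
  MemLpVarLoc u f ∧ cmoNorm u f < ∞

/-! Herz spaces -/

/-- The norm of the homogeneous Herz space:
`(∑_{l ∈ ℤ} ‖p^{l β} f χ_{S_l}‖^m)^{1/m}`, with norms in `L^{u(·)}(ℚ_pⁿ)`. -/
def herzNorm (β m : ℝ) (u : Qpn p n → ℝ) (f : Qpn p n → ℝ) : ℝ≥0∞ :=
  (∑' l : ℤ, lpNorm u
    ((sphereS p n l).indicator fun x => (p : ℝ) ^ ((l : ℝ) * β) * f x) ^ m) ^ (1 / m)

/-- `f` belongs to the homogeneous Herz space with indices `β`, `m` and `u(·)`. -/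
def MemHerz (β m : ℝ) (u : Qpn p n → ℝ) (f : Qpn p n → ℝ) : Prop :=
  MemLpVarLoc u f ∧ herzNorm β m u f < ∞

/-! Fractional Hardy operators and their commutators -/

/-- `H_α f(x) = |x|^{-(n-α)} ∫_{|t| ≤ |x|} f(t) dt` for `x ≠ 0`. -/
def hardy (α : ℝ) (f : Qpn p n → ℝ) (x : Qpn p n) : ℝ :=
  1 / ‖x‖ ^ ((n : ℝ) - α) * ∫ t in {t : Qpn p n | ‖t‖ ≤ ‖x‖}, f t ∂(haar p n)

/-- `H*_α f(x) = ∫_{|t| > |x|} f(t) / |t|^{n-α} dt` for `x ≠ 0`. -/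
def hardyAdj (α : ℝ) (f : Qpn p n → ℝ) (x : Qpn p n) : ℝ :=
  ∫ t in {t : Qpn p n | ‖x‖ < ‖t‖}, f t / ‖t‖ ^ ((n : ℝ) - α) ∂(haar p n)

/-- The integral defining `H_α f(x)` converges absolutely at every `x ≠ 0`. -/
def HardyDefined (f : Qpn p n → ℝ) : Prop :=
  ∀ x : Qpn p n, x ≠ 0 → IntegrableOn f {t : Qpn p n | ‖t‖ ≤ ‖x‖} (haar p n)

/-- The integral defining `H*_α f(x)` converges absolutely at every `x ≠ 0`. -/
def HardyAdjDefined (α : ℝ) (f : Qpn p n → ℝ) : Prop :=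
  ∀ x : Qpn p n, x ≠ 0 →
    IntegrableOn (fun t => f t / ‖t‖ ^ ((n : ℝ) - α)) {t : Qpn p n | ‖x‖ < ‖t‖} (haar p n)

/-- `H_{α,b} f = b H_α f - H_α (b f)`. -/
def hardyComm (α : ℝ) (b f : Qpn p n → ℝ) (x : Qpn p n) : ℝ :=
  b x * hardy α f x - hardy α (fun t => b t * f t) x

/-- `H*_{α,b} f = b H*_α f - H*_α (b f)`. -/
def hardyAdjComm (α : ℝ) (b f : Qpn p n → ℝ) (x : Qpn p n) : ℝ :=
  b x * hardyAdj α f x - hardyAdj α (fun t => b t * f t) x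

end PadicHerz

end

open Filter
open scoped Topology

noncomputable section

namespace PadicHerz

variable {p : ℕ} [Fact p.Prime] {n : ℕ}

/-! ### The Luxemburg norm -/

section Luxemburg

variable {u f g : Qpn p n → ℝ}

/-! The spheres `S_l` reduce everything to sequences. The class `W₀^∞` forces `|v(x) - V_l| =
O(1/|l|)` for almost every `x ∈ S_l`, where `V_l` is a constant `V₀` for `l < 0` and a constant `V₁`
for `l ≥ 0`. Powers `p^(l v(x))` are then comparable to `p^(l V_l)`, and balls have norms bounded as
for constant exponents: with `D_k = k n / V_k`, the norm of `χ_{B_k}` is at most a constant times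
`p^(D_k)` in `L^v` and, because `1/u' = 1 - 1/v - α/n`, at most a constant times `p^(k(n-α) - D_k)`
in `L^{u'}` (`lpNorm_indicator_ballB_le`, `exists_ballBounds`). The two `CMO` hypotheses give the
same bounds for `b - b_{B_k}`, and `k ↦ b_{B_k}` is Lipschitz (`mean_sub_le`).

For `x ∈ S_l` the kernels of both operators are at most `max(p^l, |t|)^(α-n)`, and `|b(x) - b(t)|`
is at most the product of `1 + |b(x) - b_{B_l}|` and `1 + |b(t) - b_{B_l}|`. Hence both commutators
are bounded on `S_l` by `(1 + |b(x) - b_{B_l}|) T_l` with `T_l` the `kernelIntegral`, and their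
`L^v` norm there is at most a constant times `p^(D_l) T_l`. Cutting `T_l` into spheres `S_k` and
applying Hölder with `u, u'` gives a discrete kernel in `l, k`. The conditions on `β` place the
slopes `n/V₀ + β` and `n/V₁ + β` strictly between `0` and `n - α`, so after weighting by `p^(lβ)`
this kernel decays like `(1 + |l-k|) p^(-δ|l-k|)` (`weighted_kernelIntegral_le`). Convolution with a
geometric sequence is bounded on every `ℓ^m`, and `ℓ^{m₁} ⊆ ℓ^{m₂}`.

Membership in `L^v_loc` needs a separate argument, since for `β > 0` the Herz norm loses control at
the origin. There the same estimate is run with weight `1` near `0`: local integrability of `f` puts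
its sphere norms in `ℓ^w` for some `w` with `u ≤ w ≤ v` near `0`, convolution preserves this, and
`ℓ^w` is enough for the modular with exponent `v` (`memLpVarLoc_of_geometric`). -/

theorem modular_mono (hu : ∀ᵐ x ∂haar p n, 0 ≤ u x)
    (hfg : ∀ᵐ x ∂haar p n, |f x| ≤ |g x|) : modular u f ≤ modular u g := by
  refine lintegral_mono_ae ?_
  filter_upwards [hu, hfg] with x hx h
  exact ENNReal.ofReal_le_ofReal (Real.rpow_le_rpow (abs_nonneg _) h hx)

theorem lpNorm_le_of_modular_le {s : ℝ} (hs : 0 < s)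
    (h : modular u (fun x => f x / s) ≤ 1) : lpNorm u f ≤ ENNReal.ofReal s :=
  sInf_le ⟨s, ⟨hs, h⟩, rfl⟩

theorem modular_div_le_one (hu : ∀ᵐ x ∂haar p n, 0 ≤ u x) {s : ℝ}
    (h : lpNorm u f < ENNReal.ofReal s) : modular u (fun x => f x / s) ≤ 1 := by
  obtain ⟨_, ⟨t, ⟨ht, hm⟩, rfl⟩, hts⟩ := sInf_lt_iff.1 h
  have hts' : t < s := (ENNReal.ofReal_lt_ofReal_iff_of_nonneg ht.le).1 hts
  refine (modular_mono hu (Eventually.of_forall fun x => ?_)).trans hm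
  rw [abs_div, abs_div, abs_of_pos ht, abs_of_pos (ht.trans hts')]
  gcongr

theorem lpNorm_mono (hu : ∀ᵐ x ∂haar p n, 0 ≤ u x)
    (hfg : ∀ᵐ x ∂haar p n, |f x| ≤ |g x|) : lpNorm u f ≤ lpNorm u g := by
  refine le_sInf ?_
  rintro _ ⟨s, ⟨hs, hm⟩, rfl⟩
  refine lpNorm_le_of_modular_le hs ((modular_mono hu ?_).trans hm)
  filter_upwards [hfg] with x hx
  rw [abs_div, abs_div]
  gcongr

theorem lpNorm_const_mul_le {c : ℝ} (hc : 0 < c) :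
    lpNorm u (fun x => c * f x) ≤ ENNReal.ofReal c * lpNorm u f := by
  have hc' : ENNReal.ofReal c ≠ 0 := (ENNReal.ofReal_pos.2 hc).ne'
  rw [mul_comm, ← ENNReal.div_le_iff_le_mul (.inl hc') (.inl ENNReal.ofReal_ne_top)]
  refine le_sInf ?_
  rintro _ ⟨s, ⟨hs, hm⟩, rfl⟩
  rw [ENNReal.div_le_iff_le_mul (.inl hc') (.inl ENNReal.ofReal_ne_top), mul_comm,
    ← ENNReal.ofReal_mul hc.le]
  refine lpNorm_le_of_modular_le (by positivity) ?_
  simpa only [mul_div_mul_left _ _ hc.ne'] using hm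

theorem lpNorm_const_mul {c : ℝ} (hc : 0 < c) :
    lpNorm u (fun x => c * f x) = ENNReal.ofReal c * lpNorm u f := by
  refine le_antisymm (lpNorm_const_mul_le hc) ?_
  have h := lpNorm_const_mul_le (u := u) (f := fun x => c * f x) (inv_pos.2 hc)
  simp only [inv_mul_cancel_left₀ hc.ne'] at h
  calc ENNReal.ofReal c * lpNorm u f
      ≤ ENNReal.ofReal c * (ENNReal.ofReal c⁻¹ * lpNorm u (fun x => c * f x)) := by gcongr
    _ = lpNorm u (fun x => c * f x) := by
        rw [← mul_assoc, ← ENNReal.ofReal_mul hc.le, mul_inv_cancel₀ hc.ne']; simp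

theorem measurable_rpow_exponent (hu : Measurable u) (hf : AEMeasurable f (haar p n)) :
    AEMeasurable (fun x => ENNReal.ofReal (|f x| ^ u x)) (haar p n) := by
  have : AEMeasurable (fun x => |f x|) (haar p n) := hf.abs
  exact (this.pow hu.aemeasurable).ennreal_ofReal

/-- Convexity of `t ↦ t^(u x)`: for `s`, `t` slightly above the two norms, `(f + g)/(s + t)` is the
convex combination of `f/s` and `g/t` with weights `s/(s+t)` and `t/(s+t)`. -/
theorem lpNorm_add_le (hum : Measurable u) (hu : ∀ᵐ x ∂haar p n, 1 ≤ u x)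
    (hf : AEMeasurable f (haar p n)) :
    lpNorm u (fun x => f x + g x) ≤ lpNorm u f + lpNorm u g := by
  refine ENNReal.le_of_forall_pos_le_add fun ε hε hfin => ?_
  rw [ENNReal.add_lt_top] at hfin
  obtain ⟨a, ha⟩ : ∃ a : NNReal, (a : ℝ≥0∞) = lpNorm u f := ⟨_, ENNReal.coe_toNNReal hfin.1.ne⟩
  obtain ⟨c, hc⟩ : ∃ a : NNReal, (a : ℝ≥0∞) = lpNorm u g := ⟨_, ENNReal.coe_toNNReal hfin.2.ne⟩
  have hu0 : ∀ᵐ x ∂haar p n, 0 ≤ u x := hu.mono fun x hx => zero_le_one.trans hx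
  set s : ℝ := a + ε / 2
  set t : ℝ := c + ε / 2
  have hε' : (0 : ℝ) < ε := by exact_mod_cast hε
  have hs : 0 < s := by positivity
  have ht : 0 < t := by positivity
  have h1 : modular u (fun x => f x / s) ≤ 1 := modular_div_le_one hu0 (by
    rw [← ha, ← ENNReal.ofReal_coe_nnreal]
    exact (ENNReal.ofReal_lt_ofReal_iff hs).2 (by simp only [s]; linarith))
  have h2 : modular u (fun x => g x / t) ≤ 1 := modular_div_le_one hu0 (by
    rw [← hc, ← ENNReal.ofReal_coe_nnreal]
    exact (ENNReal.ofReal_lt_ofReal_iff ht).2 (by simp only [t]; linarith))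
  have hst : (lpNorm u f + lpNorm u g + ε : ℝ≥0∞) = ENNReal.ofReal (s + t) := by
    rw [← ha, ← hc, ← ENNReal.ofReal_coe_nnreal, ← ENNReal.ofReal_coe_nnreal (p := c),
      ← ENNReal.ofReal_coe_nnreal (p := ε), ← ENNReal.ofReal_add, ← ENNReal.ofReal_add]
    · congr 1; simp only [s, t]; ring
    all_goals positivity
  rw [hst]
  refine lpNorm_le_of_modular_le (by positivity) ?_
  have hw : s / (s + t) + t / (s + t) = 1 := by field_simp
  calc modular u (fun x => (f x + g x) / (s + t))
      ≤ ∫⁻ x, (ENNReal.ofReal (s / (s + t)) * ENNReal.ofReal (|f x / s| ^ u x)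
          + ENNReal.ofReal (t / (s + t)) * ENNReal.ofReal (|g x / t| ^ u x)) ∂haar p n := by
        refine lintegral_mono_ae ?_
        filter_upwards [hu] with x hx
        rw [← ENNReal.ofReal_mul (by positivity), ← ENNReal.ofReal_mul (by positivity),
          ← ENNReal.ofReal_add (by positivity) (by positivity)]
        refine ENNReal.ofReal_le_ofReal ?_
        have hcv := (convexOn_rpow hx).2 (Set.mem_Ici.2 (abs_nonneg (f x / s)))
          (Set.mem_Ici.2 (abs_nonneg (g x / t))) (div_nonneg hs.le (add_pos hs ht).le)
          (div_nonneg ht.le (add_pos hs ht).le) hw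
        simp only [smul_eq_mul] at hcv
        refine le_trans (Real.rpow_le_rpow (abs_nonneg _) ?_ (zero_le_one.trans hx)) hcv
        have : (f x + g x) / (s + t) = s / (s + t) * (f x / s) + t / (s + t) * (g x / t) := by
          field_simp
        rw [this]
        refine (abs_add_le _ _).trans ?_
        rw [abs_mul, abs_mul, abs_of_nonneg (div_nonneg hs.le (add_pos hs ht).le),
          abs_of_nonneg (div_nonneg ht.le (add_pos hs ht).le)]
    _ = ENNReal.ofReal (s / (s + t)) * modular u (fun x => f x / s)
        + ENNReal.ofReal (t / (s + t)) * modular u (fun x => g x / t) := by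
        rw [lintegral_add_left' ((measurable_rpow_exponent hum (hf.div_const s)).const_mul _),
          lintegral_const_mul' _ _ ENNReal.ofReal_ne_top,
          lintegral_const_mul' _ _ ENNReal.ofReal_ne_top]
        rfl
    _ ≤ ENNReal.ofReal (s / (s + t)) * 1 + ENNReal.ofReal (t / (s + t)) * 1 := by gcongr
    _ = 1 := by
        rw [mul_one, mul_one, ← ENNReal.ofReal_add (by positivity) (by positivity), hw,
          ENNReal.ofReal_one]

/-- Hölder's inequality for variable exponents. -/
theorem lintegral_abs_mul_le (hum : Measurable u) (hu : ∀ᵐ x ∂haar p n, 1 < u x)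
    (hf : AEMeasurable f (haar p n)) (hfin : lpNorm u f < ∞)
    (hgin : lpNorm (conjExp u) g < ∞) :
    ∫⁻ x, ENNReal.ofReal (|f x| * |g x|) ∂haar p n
      ≤ 2 * lpNorm u f * lpNorm (conjExp u) g := by
  have hu0 : ∀ᵐ x ∂haar p n, 0 ≤ u x := hu.mono fun x hx => zero_le_one.trans hx.le
  have hc0 : ∀ᵐ x ∂haar p n, 0 ≤ conjExp u x := hu.mono fun x hx =>
    (Real.HolderConjugate.conjExponent hx).symm.nonneg
  have key : ∀ s t : ℝ, lpNorm u f < ENNReal.ofReal s → lpNorm (conjExp u) g < ENNReal.ofReal t →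
      ∫⁻ x, ENNReal.ofReal (|f x| * |g x|) ∂haar p n
        ≤ 2 * ENNReal.ofReal s * ENNReal.ofReal t := by
    intro s t hs ht
    have hs0 : 0 < s := ENNReal.ofReal_pos.1 (bot_le.trans_lt hs)
    have ht0 : 0 < t := ENNReal.ofReal_pos.1 (bot_le.trans_lt ht)
    have h1 := modular_div_le_one hu0 hs
    have h2 := modular_div_le_one hc0 ht
    calc ∫⁻ x, ENNReal.ofReal (|f x| * |g x|) ∂haar p n
        ≤ ∫⁻ x, ENNReal.ofReal (s * t) * (ENNReal.ofReal (|f x / s| ^ u x)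
          + ENNReal.ofReal (|g x / t| ^ conjExp u x)) ∂haar p n := by
          refine lintegral_mono_ae ?_
          filter_upwards [hu] with x hx
          have hconj : (u x).HolderConjugate (conjExp u x) := Real.HolderConjugate.conjExponent hx
          rw [← ENNReal.ofReal_add (by positivity) (by positivity),
            ← ENNReal.ofReal_mul (by positivity)]
          refine ENNReal.ofReal_le_ofReal ?_
          have hy := Real.young_inequality_of_nonneg (abs_nonneg (f x / s)) (abs_nonneg (g x / t))
            hconj
          have e : |f x| * |g x| = s * t * (|f x / s| * |g x / t|) := by
            rw [abs_div, abs_div, abs_of_pos hs0, abs_of_pos ht0]; field_simp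
          rw [e]
          refine mul_le_mul_of_nonneg_left (hy.trans ?_) (by positivity)
          gcongr
          -- The Young weights `1/u` and `1/u'` are replaced by `1`, which produces the factor `2`
          -- in the conclusion.
          · exact div_le_self (by positivity) hconj.lt.le
          · exact div_le_self (by positivity) hconj.symm.lt.le
      _ = ENNReal.ofReal (s * t) * (modular u (fun x => f x / s)
          + modular (conjExp u) (fun x => g x / t)) := by
          rw [lintegral_const_mul' _ _ ENNReal.ofReal_ne_top,
            lintegral_add_left' (measurable_rpow_exponent hum (hf.div_const s))]
          rfl
      _ ≤ ENNReal.ofReal (s * t) * (1 + 1) := by gcongr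
      _ = 2 * ENNReal.ofReal s * ENNReal.ofReal t := by
          rw [ENNReal.ofReal_mul hs0.le, one_add_one_eq_two]; ring
  obtain ⟨a, ha⟩ : ∃ a : NNReal, (a : ℝ≥0∞) = lpNorm u f := ⟨_, ENNReal.coe_toNNReal hfin.ne⟩
  obtain ⟨c, hc⟩ : ∃ a : NNReal, (a : ℝ≥0∞) = lpNorm (conjExp u) g :=
    ⟨_, ENNReal.coe_toNNReal hgin.ne⟩
  rw [← ha, ← hc] at key ⊢
  have hev : ∀ᶠ ε : ℝ in 𝓝[>] 0, ∫⁻ x, ENNReal.ofReal (|f x| * |g x|) ∂haar p n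
      ≤ ENNReal.ofReal (2 * (a + ε) * (c + ε)) := by
    filter_upwards [self_mem_nhdsWithin] with ε (hε : 0 < ε)
    have := key (a + ε) (c + ε)
      (by rw [← ENNReal.ofReal_coe_nnreal]
          exact (ENNReal.ofReal_lt_ofReal_iff (by positivity)).2 (by linarith))
      (by rw [← ENNReal.ofReal_coe_nnreal]
          exact (ENNReal.ofReal_lt_ofReal_iff (by positivity)).2 (by linarith))
    rw [ENNReal.ofReal_mul (by positivity), ENNReal.ofReal_mul (by positivity)]
    simpa using this
  have hlim : Tendsto (fun ε : ℝ => ENNReal.ofReal (2 * (a + ε) * (c + ε))) (𝓝[>] 0)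
      (𝓝 (ENNReal.ofReal (2 * (a + 0) * (c + 0)))) := by
    refine (ENNReal.continuous_ofReal.comp ?_).continuousAt.tendsto.mono_left nhdsWithin_le_nhds
    fun_prop
  refine (ge_of_tendsto hlim hev).trans (le_of_eq ?_)
  rw [add_zero, add_zero, ENNReal.ofReal_mul (by positivity), ENNReal.ofReal_mul (by positivity)]
  simp

/-- For `r` above the norm, `|f|^u = r^u |f/r|^u` and `r^u ≤ r^lo + r^hi` whichever side of `1`
contains `r`; then `r` decreases to the norm. -/
theorem modular_le_rpow_add_rpow {lo hi : ℝ}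
    (hu : ∀ᵐ x ∂haar p n, f x ≠ 0 → lo ≤ u x ∧ u x ≤ hi)
    (hu0 : ∀ᵐ x ∂haar p n, 0 < u x)
    (hfin : lpNorm u f < ∞) : modular u f ≤ lpNorm u f ^ lo + lpNorm u f ^ hi := by
  have key : ∀ s : ℝ≥0∞, lpNorm u f < s → s < ∞ → modular u f ≤ s ^ lo + s ^ hi := by
    intro s hs hs'
    obtain ⟨r, rfl⟩ : ∃ r : NNReal, (r : ℝ≥0∞) = s := ⟨_, ENNReal.coe_toNNReal hs'.ne⟩
    have hr : 0 < (r : ℝ) := by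
      have : (0 : ℝ≥0∞) < r := bot_le.trans_lt hs
      exact_mod_cast this
    rw [← ENNReal.ofReal_coe_nnreal] at hs ⊢
    have hm := modular_div_le_one (hu0.mono fun x hx => hx.le) hs
    rw [ENNReal.ofReal_rpow_of_pos hr, ENNReal.ofReal_rpow_of_pos hr,
      ← ENNReal.ofReal_add (by positivity) (by positivity)]
    calc modular u f ≤ ∫⁻ x, ENNReal.ofReal ((r : ℝ) ^ lo + (r : ℝ) ^ hi) *
          ENNReal.ofReal (|f x / r| ^ u x) ∂haar p n := by
          refine lintegral_mono_ae ?_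
          filter_upwards [hu, hu0] with x hx hx0
          by_cases hfx : f x = 0
          · simp [hfx, Real.zero_rpow hx0.ne']
          obtain ⟨h1, h2⟩ := hx hfx
          rw [← ENNReal.ofReal_mul (by positivity)]
          refine ENNReal.ofReal_le_ofReal ?_
          have e : |f x| ^ u x = (r : ℝ) ^ u x * |f x / r| ^ u x := by
            rw [← Real.mul_rpow hr.le (abs_nonneg _), abs_div, abs_of_pos hr,
              mul_div_cancel₀ _ hr.ne']
          rw [e]
          refine mul_le_mul_of_nonneg_right ?_ (by positivity)
          rcases le_total 1 (r : ℝ) with h | h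
          · exact (Real.rpow_le_rpow_of_exponent_le h h2).trans (by simp; positivity)
          · exact (Real.rpow_le_rpow_of_exponent_ge hr h h1).trans (by simp; positivity)
      _ = ENNReal.ofReal ((r : ℝ) ^ lo + (r : ℝ) ^ hi) * modular u (fun x => f x / r) := by
          rw [lintegral_const_mul' _ _ ENNReal.ofReal_ne_top]; rfl
      _ ≤ _ := by
          refine (mul_le_mul_right hm _).trans ?_
          rw [mul_one]
  have hlim : Tendsto (fun s : ℝ≥0∞ => s ^ lo + s ^ hi) (𝓝[>] (lpNorm u f))
      (𝓝 (lpNorm u f ^ lo + lpNorm u f ^ hi)) :=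
    ((ENNReal.continuous_rpow_const.add
      ENNReal.continuous_rpow_const).continuousAt.tendsto).mono_left nhdsWithin_le_nhds
  have : (𝓝[>] (lpNorm u f)).NeBot := nhdsGT_neBot_of_exists_gt ⟨∞, hfin⟩
  refine ge_of_tendsto hlim ?_
  filter_upwards [Ioo_mem_nhdsGT hfin] with s hs
  exact key s hs.1 hs.2

/-- For `modular < r < 1`, dividing `f` by `r^(1/w)` multiplies the integrand by `r^(-u/w) ≤ r⁻¹`,
so the modular stays at most `1`. -/
theorem lpNorm_rpow_le_modular {w : ℝ} (hw : 0 < w) (hu0 : ∀ᵐ x ∂haar p n, 0 < u x)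
    (hu : ∀ᵐ x ∂haar p n, f x ≠ 0 → u x ≤ w) (hm : modular u f ≤ 1) :
    lpNorm u f ^ w ≤ modular u f := by
  refine le_of_forall_gt_imp_ge_of_dense fun r hr => ?_
  rcases le_or_gt 1 r with h1 | h1
  · refine le_trans ?_ h1
    refine ENNReal.rpow_le_one ?_ hw.le
    have := lpNorm_le_of_modular_le (u := u) (f := f) one_pos (by simpa using hm)
    simpa using this
  obtain ⟨r, rfl⟩ : ∃ s : NNReal, (s : ℝ≥0∞) = r :=
    ⟨_, ENNReal.coe_toNNReal (h1.trans ENNReal.one_lt_top).ne⟩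
  have hr0 : 0 < (r : ℝ) := by
    have : (0 : ℝ≥0∞) < r := bot_le.trans_lt hr
    exact_mod_cast this
  have hr1 : (r : ℝ) ≤ 1 := by exact_mod_cast h1.le
  have hle : lpNorm u f ≤ ENNReal.ofReal ((r : ℝ) ^ (1 / w)) := by
    refine lpNorm_le_of_modular_le (by positivity) ?_
    calc modular u (fun x => f x / (r : ℝ) ^ (1 / w))
        ≤ ∫⁻ x, ENNReal.ofReal (r : ℝ)⁻¹ * ENNReal.ofReal (|f x| ^ u x) ∂haar p n := by
          refine lintegral_mono_ae ?_
          filter_upwards [hu, hu0] with x hx hx0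
          by_cases hfx : f x = 0
          · simp [hfx, Real.zero_rpow hx0.ne']
          rw [← ENNReal.ofReal_mul (by positivity)]
          refine ENNReal.ofReal_le_ofReal ?_
          rw [abs_div, abs_of_pos (Real.rpow_pos_of_pos hr0 _),
            Real.div_rpow (abs_nonneg _) (by positivity), div_eq_inv_mul, ← Real.rpow_mul hr0.le]
          refine mul_le_mul_of_nonneg_right (inv_anti₀ hr0 ?_) (by positivity)
          calc (r : ℝ) = (r : ℝ) ^ (1 : ℝ) := (Real.rpow_one _).symm
            _ ≤ _ := Real.rpow_le_rpow_of_exponent_ge hr0 hr1 (by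
              rw [one_div, inv_mul_le_one₀ hw]; exact hx hfx)
      _ = ENNReal.ofReal (r : ℝ)⁻¹ * modular u f := by
          rw [lintegral_const_mul' _ _ ENNReal.ofReal_ne_top]; rfl
      _ ≤ ENNReal.ofReal (r : ℝ)⁻¹ * r := by gcongr
      _ = 1 := by
          rw [← ENNReal.ofReal_coe_nnreal, ← ENNReal.ofReal_mul (by positivity),
            inv_mul_cancel₀ hr0.ne', ENNReal.ofReal_one]
  refine (ENNReal.rpow_le_rpow hle hw.le).trans (le_of_eq ?_)
  rw [ENNReal.ofReal_rpow_of_pos (by positivity), ← Real.rpow_mul hr0.le,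
    one_div_mul_cancel hw.ne', Real.rpow_one, ENNReal.ofReal_coe_nnreal]

theorem lpNorm_lt_top_of_modular_lt_top (hu : ∀ᵐ x ∂haar p n, 1 ≤ u x)
    (hm : modular u f < ∞) : lpNorm u f < ∞ := by
  obtain ⟨a, ha⟩ : ∃ a : NNReal, (a : ℝ≥0∞) = modular u f := ⟨_, ENNReal.coe_toNNReal hm.ne⟩
  set s : ℝ := max 1 a
  have hs : 0 < s := lt_max_of_lt_left one_pos
  refine (lpNorm_le_of_modular_le hs ?_).trans_lt ENNReal.ofReal_lt_top
  calc modular u (fun x => f x / s)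
      ≤ ∫⁻ x, ENNReal.ofReal s⁻¹ * ENNReal.ofReal (|f x| ^ u x) ∂haar p n := by
        refine lintegral_mono_ae ?_
        filter_upwards [hu] with x hx
        rw [← ENNReal.ofReal_mul (by positivity)]
        refine ENNReal.ofReal_le_ofReal ?_
        rw [abs_div, abs_of_pos hs, Real.div_rpow (abs_nonneg _) hs.le, div_eq_inv_mul]
        refine mul_le_mul_of_nonneg_right (inv_anti₀ hs ?_) (by positivity)
        exact Real.self_le_rpow_of_one_le (le_max_left _ _) hx
    _ = ENNReal.ofReal s⁻¹ * a := by
        rw [lintegral_const_mul' _ _ ENNReal.ofReal_ne_top, ha]; rfl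
    _ ≤ ENNReal.ofReal s⁻¹ * ENNReal.ofReal s := by
        gcongr
        rw [← ENNReal.ofReal_coe_nnreal]
        exact ENNReal.ofReal_le_ofReal (le_max_right _ _)
    _ = 1 := by
        rw [← ENNReal.ofReal_mul (by positivity), inv_mul_cancel₀ hs.ne', ENNReal.ofReal_one]

end Luxemburg

/-! ### Balls and spheres -/

instance instIsAddHaarMeasureHaar : (haar p n).IsAddHaarMeasure := by
  unfold haar; infer_instance

theorem one_lt_p (p : ℕ) [hp : Fact p.Prime] : (1 : ℝ) < p := by exact_mod_cast hp.out.one_lt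

theorem p_pos (p : ℕ) [Fact p.Prime] : (0 : ℝ) < p := zero_lt_one.trans (one_lt_p p)

theorem ballB_eq_closedBall (a : Qpn p n) (γ : ℤ) :
    ballB a γ = Metric.closedBall a ((p : ℝ) ^ γ) := by
  ext x; simp [ballB, dist_eq_norm]

theorem isCompact_ballB (a : Qpn p n) (γ : ℤ) : IsCompact (ballB a γ) := by
  rw [ballB_eq_closedBall]; exact isCompact_closedBall _ _

theorem measurableSet_ballB (a : Qpn p n) (γ : ℤ) : MeasurableSet (ballB a γ) :=
  (isCompact_ballB a γ).isClosed.measurableSet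

theorem sphereS_eq_sphere (γ : ℤ) : sphereS p n γ = Metric.sphere 0 ((p : ℝ) ^ γ) := by
  ext x; simp [sphereS]

theorem isCompact_sphereS (γ : ℤ) : IsCompact (sphereS p n γ) := by
  rw [sphereS_eq_sphere]; exact isCompact_sphere _ _

theorem measurableSet_sphereS (γ : ℤ) : MeasurableSet (sphereS p n γ) :=
  (isCompact_sphereS γ).isClosed.measurableSet

theorem mem_ballB_zero {γ : ℤ} {x : Qpn p n} : x ∈ ballB (0 : Qpn p n) γ ↔ ‖x‖ ≤ (p : ℝ) ^ γ := by
  simp [ballB]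

theorem sphereS_subset_ballB {l k : ℤ} (h : l ≤ k) : sphereS p n l ⊆ ballB 0 k := by
  intro x hx
  rw [mem_ballB_zero]
  exact (Set.mem_ofPred.1 hx).le.trans (zpow_le_zpow_right₀ (one_lt_p p).le h)

theorem ballB_subset_ballB {l k : ℤ} (h : l ≤ k) : ballB (0 : Qpn p n) l ⊆ ballB 0 k := by
  intro x hx
  rw [mem_ballB_zero] at hx ⊢
  exact hx.trans (zpow_le_zpow_right₀ (one_lt_p p).le h)

theorem exists_mem_sphereS {x : Qpn p n} (hx : x ≠ 0) : ∃ l : ℤ, x ∈ sphereS p n l := by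
  have hne : Nonempty (Fin n) := by
    by_contra h
    rw [not_nonempty_iff] at h
    exact hx (Subsingleton.elim _ _)
  obtain ⟨i, -, hi⟩ := Finset.exists_max_image Finset.univ (fun i => ‖x i‖) Finset.univ_nonempty
  have hxi : ‖x‖ = ‖x i‖ := le_antisymm
    ((pi_norm_le_iff_of_nonneg (norm_nonneg _)).2 fun j => hi j (Finset.mem_univ _))
    (norm_le_pi_norm x i)
  have h0 : x i ≠ 0 := by
    intro h
    rw [h, norm_zero, norm_eq_zero] at hxi
    exact hx hxi
  exact ⟨_, hxi.trans (Padic.norm_eq_zpow_neg_valuation h0)⟩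

theorem sphereS_index_injective {l k : ℤ} {x : Qpn p n} (hl : x ∈ sphereS p n l)
    (hk : x ∈ sphereS p n k) : l = k :=
  zpow_right_injective₀ (p_pos p) (one_lt_p p).ne' ((Set.mem_ofPred.1 hl).symm.trans hk)

theorem disjoint_sphereS : Pairwise (Function.onFun Disjoint (sphereS p n)) := fun _ _ h =>
  Set.disjoint_left.2 fun _ hi hj => h (sphereS_index_injective hi hj)

theorem iUnion_sphereS : ⋃ l, sphereS p n l = {0}ᶜ := by
  ext x
  simp only [Set.mem_iUnion, Set.mem_compl_iff, Set.mem_singleton_iff]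
  refine ⟨?_, exists_mem_sphereS⟩
  rintro ⟨l, hl⟩ rfl
  rw [sphereS, Set.mem_ofPred_eq, norm_zero] at hl
  exact (zpow_pos (p_pos p) l).ne hl

/-- The digit is the residue modulo `p` of the `p`-adic integer `p^γ y`. -/
theorem exists_digit (γ : ℤ) {y : ℚ_[p]} (hy : ‖y‖ ≤ (p : ℝ) ^ γ) :
    ∃ c : Fin p, ‖y - (p : ℚ_[p]) ^ (-γ) * (c : ℕ)‖ ≤ (p : ℝ) ^ (γ - 1) := by
  have hp0 : (p : ℚ_[p]) ≠ 0 := by exact_mod_cast (Fact.out : p.Prime).ne_zero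
  have hz : ‖(p : ℚ_[p]) ^ γ * y‖ ≤ 1 := by
    rw [norm_mul, Padic.norm_p_zpow, zpow_neg, inv_mul_le_one₀ (zpow_pos (p_pos p) _)]
    exact hy
  obtain ⟨c, hc, hm⟩ := PadicInt.exists_mem_range (⟨_, hz⟩ : ℤ_[p])
  refine ⟨⟨c, hc⟩, ?_⟩
  rw [PadicInt.maximalIdeal_eq_span_p, Ideal.mem_span_singleton, ← PadicInt.norm_lt_one_iff_dvd]
    at hm
  have hm' := (PadicInt.norm_le_pow_iff_norm_lt_pow_add_one _ (-1)).2 (by simpa using hm)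
  have e : y - (p : ℚ_[p]) ^ (-γ) * (c : ℕ) = (p : ℚ_[p]) ^ (-γ) * ((p : ℚ_[p]) ^ γ * y - c) := by
    rw [mul_sub, ← mul_assoc, ← zpow_add₀ hp0]; simp
  rw [e, norm_mul, Padic.norm_p_zpow, neg_neg, sub_eq_add_neg γ 1, zpow_add₀ (p_pos p).ne']
  exact mul_le_mul_of_nonneg_left hm' (zpow_nonneg (p_pos p).le _)

theorem digit_injective (γ : ℤ) {y : ℚ_[p]} {c d : Fin p}
    (hc : ‖y - (p : ℚ_[p]) ^ (-γ) * (c : ℕ)‖ ≤ (p : ℝ) ^ (γ - 1))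
    (hd : ‖y - (p : ℚ_[p]) ^ (-γ) * (d : ℕ)‖ ≤ (p : ℝ) ^ (γ - 1)) : c = d := by
  have h : ‖(p : ℚ_[p]) ^ (-γ) * (((c : ℕ) : ℤ) - ((d : ℕ) : ℤ) : ℤ)‖ ≤ (p : ℝ) ^ (γ - 1) := by
    have e : (p : ℚ_[p]) ^ (-γ) * (((c : ℕ) : ℤ) - ((d : ℕ) : ℤ) : ℤ) =
        (y - (p : ℚ_[p]) ^ (-γ) * (d : ℕ)) - (y - (p : ℚ_[p]) ^ (-γ) * (c : ℕ)) := by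
      push_cast; ring
    rw [e]
    rw [sub_eq_add_neg]
    refine (IsUltrametricDist.norm_add_le_max _ _).trans (max_le hd ?_)
    rwa [norm_neg]
  rw [norm_mul, Padic.norm_p_zpow, neg_neg, sub_eq_add_neg γ 1, zpow_add₀ (p_pos p).ne',
    mul_le_mul_iff_right₀ (zpow_pos (p_pos p) _)] at h
  have h1 : ‖((((c : ℕ) : ℤ) - ((d : ℕ) : ℤ) : ℤ) : ℚ_[p])‖ < 1 :=
    h.trans_lt (by rw [zpow_neg_one]; exact inv_lt_one_of_one_lt₀ (one_lt_p p))
  rw [Padic.norm_intCast_lt_one_iff] at h1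
  obtain ⟨k, hk⟩ := h1
  have hc' := c.2
  have hd' := d.2
  have hk0 : k = 0 := by
    by_contra hk0
    have : (p : ℤ) ≤ |(p : ℤ) * k| := by
      rw [abs_mul, Nat.abs_cast]
      exact le_mul_of_one_le_right (by positivity) (Int.one_le_abs hk0)
    rw [← hk] at this
    have h2 : |((c : ℕ) : ℤ) - ((d : ℕ) : ℤ)| < p := by rw [abs_lt]; constructor <;> omega
    omega
  ext
  rw [hk0] at hk
  omega

theorem haar_ballB (a : Qpn p n) (γ : ℤ) : haar p n (ballB a γ) = haar p n (ballB 0 γ) := by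
  rw [← measure_preimage_add_right (haar p n) (-a) (ballB 0 γ)]
  congr 1
  ext x
  simp [ballB, sub_eq_add_neg]

/-- The leading digits of the `n` coordinates split `B_γ` into `p^n` disjoint translates of
`B_{γ-1}`. -/
theorem haar_ballB_succ (γ : ℤ) :
    haar p n (ballB 0 γ) = (p : ℝ≥0∞) ^ n * haar p n (ballB 0 (γ - 1)) := by
  let e : (Fin n → Fin p) → Qpn p n := fun c j => (p : ℚ_[p]) ^ (-γ) * (c j : ℕ)
  have hmem : ∀ (x : Qpn p n) c, x ∈ ballB (e c) (γ - 1) ↔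
      ∀ j, ‖x j - (p : ℚ_[p]) ^ (-γ) * (c j : ℕ)‖ ≤ (p : ℝ) ^ (γ - 1) := fun x c => by
    rw [ballB, Set.mem_ofPred_eq, pi_norm_le_iff_of_nonneg (zpow_nonneg (p_pos p).le _)]
    rfl
  have hU : ballB (0 : Qpn p n) γ = ⋃ c, ballB (e c) (γ - 1) := by
    ext x
    simp only [Set.mem_iUnion, hmem]
    rw [mem_ballB_zero, pi_norm_le_iff_of_nonneg (zpow_nonneg (p_pos p).le _)]
    constructor
    · intro h
      choose c hc using fun j => exists_digit γ (h j)
      exact ⟨c, hc⟩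
    · rintro ⟨c, hc⟩ j
      have e1 : x j = (x j - (p : ℚ_[p]) ^ (-γ) * (c j : ℕ)) + (p : ℚ_[p]) ^ (-γ) * (c j : ℕ) := by
        ring
      rw [e1]
      refine (IsUltrametricDist.norm_add_le_max _ _).trans (max_le ((hc j).trans ?_) ?_)
      · exact zpow_le_zpow_right₀ (one_lt_p p).le (by omega)
      · rw [norm_mul, Padic.norm_p_zpow, neg_neg]
        exact mul_le_of_le_one_right (zpow_nonneg (p_pos p).le _)
          (by simpa using Padic.norm_int_le_one (p := p) (c j : ℕ))
  rw [hU, measure_iUnion]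
  · simp only [haar_ballB, tsum_fintype, Finset.sum_const, nsmul_eq_mul]
    simp
  · intro c d hcd
    refine Set.disjoint_left.2 fun x hx hy => hcd ?_
    rw [hmem] at hx hy
    exact funext fun j => digit_injective γ (hx j) (hy j)
  · exact fun c => measurableSet_ballB _ _

theorem p_ne_zero (p : ℕ) [hp : Fact p.Prime] : (p : ℝ≥0∞) ≠ 0 := by
  exact_mod_cast hp.out.ne_zero

theorem one_le_p (p : ℕ) [hp : Fact p.Prime] : (1 : ℝ≥0∞) ≤ p := by
  exact_mod_cast hp.out.one_lt.le

theorem haar_ballB_zero (γ : ℤ) :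
    haar p n (ballB 0 γ) = (p : ℝ≥0∞) ^ ((γ : ℝ) * n) := by
  have h0 : haar p n (ballB 0 0) = 1 := by
    have : ballB (0 : Qpn p n) 0 = (unitBall p n : Set (Qpn p n)) := by
      rw [ballB_eq_closedBall, zpow_zero]; rfl
    rw [this]; exact Measure.addHaarMeasure_self
  induction γ using Int.induction_on with
  | zero => simpa using h0
  | succ i ih =>
    rw [haar_ballB_succ, add_sub_cancel_right, ih, ← ENNReal.rpow_natCast,
      ← ENNReal.rpow_add _ _ (p_ne_zero p) (ENNReal.natCast_ne_top p)]
    congr 1; push_cast; ring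
  | pred i ih =>
    have h := haar_ballB_succ (p := p) (n := n) (-(i : ℤ))
    rw [ih] at h
    have hne : (p : ℝ≥0∞) ^ n ≠ 0 := pow_ne_zero _ (p_ne_zero p)
    have hnt : (p : ℝ≥0∞) ^ n ≠ ⊤ := ENNReal.pow_ne_top (ENNReal.natCast_ne_top p)
    rw [← ENNReal.mul_right_inj hne hnt, ← h, ← ENNReal.rpow_natCast,
      ← ENNReal.rpow_add _ _ (p_ne_zero p) (ENNReal.natCast_ne_top p)]
    congr 1; push_cast; ring

theorem haar_sphereS_le (l : ℤ) : haar p n (sphereS p n l) ≤ (p : ℝ≥0∞) ^ ((l : ℝ) * n) :=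
  (measure_mono (sphereS_subset_ballB le_rfl)).trans (haar_ballB_zero l).le

theorem haar_sphereS_ne_zero (hn : n ≠ 0) (l : ℤ) : haar p n (sphereS p n l) ≠ 0 := by
  intro h
  have hsub : ballB (0 : Qpn p n) l ⊆ ballB 0 (l - 1) ∪ sphereS p n l := by
    intro x hx
    rw [mem_ballB_zero] at hx
    by_cases hx0 : x = 0
    · left; rw [mem_ballB_zero, hx0, norm_zero]; exact zpow_nonneg (p_pos p).le _
    obtain ⟨k, hk⟩ := exists_mem_sphereS hx0
    have hk' : ‖x‖ = (p : ℝ) ^ k := hk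
    rw [hk', zpow_le_zpow_iff_right₀ (one_lt_p p)] at hx
    rcases hx.eq_or_lt with rfl | hlt
    · exact Or.inr hk
    · exact Or.inl (sphereS_subset_ballB (by omega) hk)
  have h1 := (measure_mono hsub).trans (measure_union_le (μ := haar p n) _ _)
  rw [h, add_zero, haar_ballB_zero, haar_ballB_zero] at h1
  refine absurd h1 (not_le.2 ?_)
  refine ENNReal.rpow_lt_rpow_of_exponent_lt (by exact_mod_cast (Fact.out : p.Prime).one_lt)
    (ENNReal.natCast_ne_top p) ?_
  have : (0 : ℝ) < n := by positivity
  push_cast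
  nlinarith

/-- The origin lies in balls of mass `p^(-kn)`, which tends to `0` only because `n > 0`; for `n = 0`
the point carries all the mass. -/
theorem haar_singleton_zero (hn : n ≠ 0) : haar p n {0} = 0 := by
  have hlim : Tendsto (fun k : ℕ => ((p : ℝ≥0∞) ^ n)⁻¹ ^ k) atTop (𝓝 0) := by
    refine ENNReal.tendsto_pow_atTop_nhds_zero_of_lt_one (ENNReal.inv_lt_one.2 ?_)
    exact one_lt_pow₀ (by exact_mod_cast (Fact.out : p.Prime).one_lt) hn
  refine le_antisymm (ge_of_tendsto hlim (Eventually.of_forall fun k => ?_)) zero_le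
  have hsub : ({0} : Set (Qpn p n)) ⊆ ballB 0 (-(k : ℤ)) := by
    rintro x rfl
    rw [mem_ballB_zero, norm_zero]; exact zpow_nonneg (p_pos p).le _
  refine (measure_mono hsub).trans (le_of_eq ?_)
  rw [haar_ballB_zero, ← ENNReal.rpow_natCast, ← ENNReal.rpow_natCast, ← ENNReal.rpow_neg_one,
    ← ENNReal.rpow_mul, ← ENNReal.rpow_mul]
  congr 1; push_cast; ring

theorem ae_ne_zero (hn : n ≠ 0) : ∀ᵐ x ∂haar p n, x ≠ 0 := by
  rw [ae_iff]; simpa using haar_singleton_zero hn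

theorem lintegral_eq_tsum_sphereS (hn : n ≠ 0) (F : Qpn p n → ℝ≥0∞) :
    ∫⁻ x, F x ∂haar p n = ∑' l, ∫⁻ x in sphereS p n l, F x ∂haar p n := by
  rw [← lintegral_iUnion measurableSet_sphereS disjoint_sphereS, iUnion_sphereS,
    Measure.restrict_eq_self_of_ae_mem (s := {0}ᶜ) (ae_ne_zero hn)]

/-! ### Log-Hölder exponents on spheres -/

/-- Values picked from each `T i` have a convergent subsequence by compactness of `[lo, hi]`.
Letting `j → ∞` along it in the oscillation bound replaces `v y` by the limit. -/
theorem exists_limit_of_oscillation {X : Type*} (v : X → ℝ) (T : ℕ → Set X)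
    (hne : ∀ i, (T i).Nonempty) {C lo hi : ℝ}
    (h : ∀ i j x y, i ≤ j → x ∈ T i → y ∈ T j → i * |v x - v y| ≤ C)
    (hb : ∀ i, ∀ x ∈ T i, v x ∈ Set.Icc lo hi) :
    ∃ V ∈ Set.Icc lo hi, ∀ i, ∀ x ∈ T i, i * |v x - V| ≤ C := by
  choose x hx using hne
  obtain ⟨V, hV, φ, hφ, hlim⟩ := isCompact_Icc.tendsto_subseq fun i => hb i (x i) (hx i)
  refine ⟨V, hV, fun i y hy => ?_⟩
  have hl : Tendsto (fun k => i * |v y - v (x (φ k))|) atTop (𝓝 (i * |v y - V|)) :=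
    ((tendsto_const_nhds.sub hlim).abs).const_mul _
  refine le_of_tendsto hl ?_
  filter_upwards [eventually_ge_atTop i] with k hk
  exact h i _ y _ (hk.trans (hφ.id_le k)) hy (hx _)

/-- The `W₀` condition on balls centred at `0` yields `V₀`, and the decay condition at infinity
yields `V₁`. The factor `|l|` makes the claim empty at `l = 0`. -/
theorem exists_sphere_limits (hn : n ≠ 0) {v : Qpn p n → ℝ} (hv : MemW0Infty v) {lo hi : ℝ}
    (hb : ∀ᵐ x ∂haar p n, v x ∈ Set.Icc lo hi) :
    ∃ V₀ ∈ Set.Icc lo hi, ∃ V₁ ∈ Set.Icc lo hi, ∃ C : ℝ, ∀ᵐ x ∂haar p n, ∀ l : ℤ,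
      x ∈ sphereS p n l → |(l : ℝ)| * |v x - (if l < 0 then V₀ else V₁)| ≤ C := by
  obtain ⟨⟨-, C₀, hC₀, h0⟩, -, C₁, hC₁, h1⟩ := hv
  have hae : ∀ᵐ x ∂haar p n, v x ∈ Set.Icc lo hi ∧ ∀ γ : ℤ, x ∈ ballB (0 : Qpn p n) γ →
      essInf v ((haar p n).restrict (ballB 0 γ)) ≤ v x ∧
      v x ≤ essSup v ((haar p n).restrict (ballB 0 γ)) := by
    refine hb.and (ae_all_iff.2 fun γ => ?_)
    rw [← ae_restrict_iff' (measurableSet_ballB 0 γ)]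
    have hr := ae_restrict_of_ae (s := ballB 0 γ) hb
    have i1 : IsBoundedUnder (· ≥ ·) (ae ((haar p n).restrict (ballB 0 γ))) v :=
      ⟨lo, eventually_map.2 (hr.mono fun x hx => hx.1)⟩
    have i2 : IsBoundedUnder (· ≤ ·) (ae ((haar p n).restrict (ballB 0 γ))) v :=
      ⟨hi, eventually_map.2 (hr.mono fun x hx => hx.2)⟩
    exact (ae_essInf_le i1).and (ae_le_essSup i2)
  -- Essential bounds hold only almost everywhere; spheres have positive measure, so each contains
  -- points where all of them hold.
  have hne : ∀ l : ℤ, (sphereS p n l ∩ {x | v x ∈ Set.Icc lo hi ∧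
      ∀ γ : ℤ, x ∈ ballB (0 : Qpn p n) γ →
      essInf v ((haar p n).restrict (ballB 0 γ)) ≤ v x ∧
      v x ≤ essSup v ((haar p n).restrict (ballB 0 γ))}).Nonempty := by
    intro l
    refine nonempty_of_measure_ne_zero (μ := haar p n) ?_
    rw [Set.inter_comm]
    exact (Measure.measure_inter_eq_of_ae (s := sphereS p n l) hae).trans_ne
      (haar_sphereS_ne_zero hn l)
  obtain ⟨V₀, hV₀, hl₀⟩ := exists_limit_of_oscillation v (fun i : ℕ => _) (fun i : ℕ => hne (-i))
    (C := C₀) (lo := lo) (hi := hi) (by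
      rintro i j x y hij ⟨hx, -, hx'⟩ ⟨hy, -, hy'⟩
      have a1 := hx' (-i) (sphereS_subset_ballB le_rfl hx)
      have a2 := hy' (-i) (sphereS_subset_ballB (by omega) hy)
      -- For `γ = -i` the condition reads `i (sup - inf) ≤ C₀`, a bound on the oscillation over
      -- `B_{-i}`; for `γ ≥ 0` it carries no information.
      have := h0 0 (-i)
      push_cast at this
      have h3 : |v x - v y| ≤ essSup v ((haar p n).restrict (ballB 0 (-i)))
          - essInf v ((haar p n).restrict (ballB 0 (-i))) := by
        rw [abs_le]; constructor <;> linarith [a1.1, a1.2, a2.1, a2.2]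
      nlinarith [mul_le_mul_of_nonneg_left h3 (Nat.cast_nonneg (α := ℝ) i)])
    (fun i x hx => hx.2.1)
  obtain ⟨V₁, hV₁, hl₁⟩ := exists_limit_of_oscillation v (fun i : ℕ => _) (fun i : ℕ => hne i)
    (C := C₁) (lo := lo) (hi := hi) (by
      rintro i j x y hij ⟨hx, -⟩ ⟨hy, -⟩
      have hx2 : ‖x‖ = (p : ℝ) ^ (i : ℤ) := hx
      have hy2 : ‖y‖ = (p : ℝ) ^ (j : ℤ) := hy
      have hm : min ‖y‖ ‖x‖ = (p : ℝ) ^ i := by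
        rw [min_eq_right, hx2, zpow_natCast]
        rw [hx2, hy2]
        exact zpow_le_zpow_right₀ (one_lt_p p).le (by omega)
      have h := h1 x y
      rw [hm] at h
      rcases Nat.eq_zero_or_pos i with rfl | hi
      · simpa using hC₁.le
      have hi' : (0 : ℝ) < i := by exact_mod_cast hi
      have hlog : (i : ℝ) ≤ Real.logb p (p + (p : ℝ) ^ i) := by
        rw [Real.le_logb_iff_rpow_le (one_lt_p p) (by have := p_pos p; positivity),
          Real.rpow_natCast]
        linarith [p_pos p]
      calc (i : ℝ) * |v x - v y| ≤ i * (C₁ * (1 / i)) := by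
            refine mul_le_mul_of_nonneg_left (h.trans ?_) hi'.le
            gcongr
        _ = C₁ := by field_simp)
    (fun i x hx => hx.2.1)
  refine ⟨V₀, hV₀, V₁, hV₁, max C₀ C₁, ?_⟩
  filter_upwards [hae] with x hx l hl
  split_ifs with hl0
  · obtain ⟨i, rfl⟩ : ∃ i : ℕ, l = -i := ⟨l.natAbs, by omega⟩
    refine le_trans ?_ (le_max_left _ _)
    have := hl₀ i x ⟨hl, hx⟩
    simpa using this
  · obtain ⟨i, rfl⟩ : ∃ i : ℕ, l = i := ⟨l.natAbs, by omega⟩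
    refine le_trans ?_ (le_max_right _ _)
    have := hl₁ i x ⟨hl, hx⟩
    simpa using this

/-! ### Sequences -/

theorem p_rpow_add (x y : ℝ) : (p : ℝ≥0∞) ^ (x + y) = (p : ℝ≥0∞) ^ x * (p : ℝ≥0∞) ^ y :=
  ENNReal.rpow_add _ _ (p_ne_zero p) (ENNReal.natCast_ne_top p)

theorem p_rpow_mono {x y : ℝ} (h : x ≤ y) : (p : ℝ≥0∞) ^ x ≤ (p : ℝ≥0∞) ^ y :=
  ENNReal.rpow_le_rpow_of_exponent_le (one_le_p p) h

theorem p_rpow_ne_top (x : ℝ) : (p : ℝ≥0∞) ^ x ≠ ∞ :=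
  ENNReal.rpow_ne_top_of_ne_zero (p_ne_zero p) (ENNReal.natCast_ne_top p)

theorem p_rpow_ne_zero (x : ℝ) : (p : ℝ≥0∞) ^ x ≠ 0 :=
  (ENNReal.rpow_pos (pos_iff_ne_zero.2 (p_ne_zero p)) (ENNReal.natCast_ne_top p)).ne'

theorem ofReal_p_rpow (x : ℝ) : ENNReal.ofReal ((p : ℝ) ^ x) = (p : ℝ≥0∞) ^ x := by
  rw [← ENNReal.ofReal_rpow_of_pos (p_pos p), ENNReal.ofReal_natCast]

theorem tsum_geometric_int_ne_top {ε : ℝ} (hε : 0 < ε) :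
    ∑' k : ℤ, (p : ℝ≥0∞) ^ (-(ε * |(k : ℝ)|)) ≠ ∞ := by
  have hr : (p : ℝ≥0∞) ^ (-ε) < 1 := by
    rw [← ENNReal.rpow_zero (x := (p : ℝ≥0∞))]
    exact ENNReal.rpow_lt_rpow_of_exponent_lt (by exact_mod_cast (Fact.out : p.Prime).one_lt)
      (ENNReal.natCast_ne_top p) (by linarith)
  have hgeo : ∑' k : ℕ, ((p : ℝ≥0∞) ^ (-ε)) ^ k ≠ ∞ := by
    rw [ENNReal.tsum_geometric]
    exact ENNReal.inv_ne_top.2 (tsub_pos_of_lt hr).ne'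
  rw [tsum_of_nat_of_neg_add_one ENNReal.summable ENNReal.summable]
  refine ENNReal.add_ne_top.2 ⟨?_, ?_⟩
  · convert hgeo using 4 with k
    rw [← ENNReal.rpow_natCast, ← ENNReal.rpow_mul]
    congr 1; simp
  · refine ne_top_of_le_ne_top hgeo (ENNReal.tsum_le_tsum fun k => ?_)
    rw [← ENNReal.rpow_natCast, ← ENNReal.rpow_mul]
    refine p_rpow_mono ?_
    have : |((-((k : ℤ) + 1) : ℤ) : ℝ)| = k + 1 := by
      push_cast; rw [abs_neg, abs_of_nonneg]; positivity
    rw [this]; nlinarith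

theorem tsum_geometric_sub {p : ℕ} (ε : ℝ) (l : ℤ) :
    ∑' k : ℤ, (p : ℝ≥0∞) ^ (-(ε * |(l : ℝ) - k|)) = ∑' k : ℤ, (p : ℝ≥0∞) ^ (-(ε * |(k : ℝ)|)) := by
  rw [← (Equiv.subLeft l).tsum_eq]
  simp

theorem tsum_geometric_sub' {p : ℕ} (ε : ℝ) (k : ℤ) :
    ∑' l : ℤ, (p : ℝ≥0∞) ^ (-(ε * |(l : ℝ) - k|)) = ∑' k : ℤ, (p : ℝ≥0∞) ^ (-(ε * |(k : ℝ)|)) := by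
  rw [← tsum_geometric_sub ε k]
  simp only [abs_sub_comm]

theorem le_tsum_rpow {ι : Type*} (c : ι → ℝ≥0∞) {m : ℝ} (hm : 0 < m) (i : ι) :
    c i ≤ (∑' j, c j ^ m) ^ (1 / m) := by
  calc c i = (c i ^ m) ^ (1 / m) := by
        rw [← ENNReal.rpow_mul, mul_one_div_cancel hm.ne', ENNReal.rpow_one]
    _ ≤ _ := ENNReal.rpow_le_rpow (ENNReal.le_tsum i) (by positivity)

/-- Convolution with a two-sided geometric sequence is bounded on `ℓ^m` for every `m > 0`. -/
theorem tsum_geometric_conv_rpow_le {ε m : ℝ} (hε : 0 < ε) (hm : 0 < m) :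
    ∃ C : ℝ≥0∞, C ≠ ∞ ∧ ∀ a : ℤ → ℝ≥0∞,
      ∑' l : ℤ, (∑' k : ℤ, (p : ℝ≥0∞) ^ (-(ε * |(l : ℝ) - k|)) * a k) ^ m
        ≤ C * ∑' k, a k ^ m := by
  refine ⟨(∑' k : ℤ, (p : ℝ≥0∞) ^ (-(ε / 2 * |(k : ℝ)|))) ^ m *
    ∑' k : ℤ, (p : ℝ≥0∞) ^ (-(ε / 2 * m * |(k : ℝ)|)), ENNReal.mul_ne_top
      (ENNReal.rpow_ne_top_of_nonneg hm.le (tsum_geometric_int_ne_top (half_pos hε)))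
      (tsum_geometric_int_ne_top (by positivity)), fun a => ?_⟩
  set G := ∑' k : ℤ, (p : ℝ≥0∞) ^ (-(ε / 2 * |(k : ℝ)|)) with hG
  have h1 : ∀ l : ℤ, (∑' k : ℤ, (p : ℝ≥0∞) ^ (-(ε * |(l : ℝ) - k|)) * a k) ^ m ≤
      G ^ m * ∑' k : ℤ, (p : ℝ≥0∞) ^ (-(ε / 2 * m * |(l : ℝ) - k|)) * a k ^ m := by
    intro l
    set c : ℤ → ℝ≥0∞ := fun k => (p : ℝ≥0∞) ^ (-(ε / 2 * |(l : ℝ) - k|)) * a k with hc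
    calc (∑' k : ℤ, (p : ℝ≥0∞) ^ (-(ε * |(l : ℝ) - k|)) * a k) ^ m
        ≤ (∑' k : ℤ, (p : ℝ≥0∞) ^ (-(ε / 2 * |(l : ℝ) - k|)) *
            -- Half of the decay stays outside to make the sum over `k` finite; the other half goes
            -- into `c`, whose terms are bounded by its `ℓ^m` quantity. No triangle inequality is
            -- used, so `m < 1` is allowed.
            (∑' j, c j ^ m) ^ (1 / m)) ^ m := by
          refine ENNReal.rpow_le_rpow (ENNReal.tsum_le_tsum fun k => ?_) hm.le
          have e : (p : ℝ≥0∞) ^ (-(ε * |(l : ℝ) - k|)) * a k =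
              (p : ℝ≥0∞) ^ (-(ε / 2 * |(l : ℝ) - k|)) * c k := by
            rw [hc, ← mul_assoc, ← p_rpow_add]; congr 2; ring
          rw [e]
          exact mul_le_mul_right (le_tsum_rpow c hm k) _
      _ = G ^ m * ∑' j, c j ^ m := by
          rw [ENNReal.tsum_mul_right, tsum_geometric_sub, ENNReal.mul_rpow_of_nonneg _ _ hm.le,
            ← ENNReal.rpow_mul, one_div_mul_cancel hm.ne', ENNReal.rpow_one]
      _ = _ := by
          congr 1
          refine tsum_congr fun k => ?_
          rw [hc, ENNReal.mul_rpow_of_nonneg _ _ hm.le, ← ENNReal.rpow_mul]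
          congr 2; ring
  calc _ ≤ ∑' l : ℤ, G ^ m * ∑' k : ℤ, (p : ℝ≥0∞) ^ (-(ε / 2 * m * |(l : ℝ) - k|)) * a k ^ m :=
        ENNReal.tsum_le_tsum h1
    _ = G ^ m * ∑' k : ℤ, ∑' l : ℤ, (p : ℝ≥0∞) ^ (-(ε / 2 * m * |(l : ℝ) - k|)) * a k ^ m := by
        rw [ENNReal.tsum_mul_left, ENNReal.tsum_comm]
    _ = _ := by
        simp_rw [ENNReal.tsum_mul_right, tsum_geometric_sub', ENNReal.tsum_mul_left]
        rw [mul_assoc]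

/-- The inclusion `ℓ^{m₁} ⊆ ℓ^{m₂}`: each term is at most `S^(1/m₁)`, which bounds the surplus power
`c i ^ (m₂ - m₁)`. -/
theorem tsum_rpow_le_tsum_rpow {ι : Type*} (c : ι → ℝ≥0∞) {m₁ m₂ : ℝ} (h₁ : 0 < m₁)
    (h₂ : m₁ ≤ m₂) : ∑' i, c i ^ m₂ ≤ (∑' i, c i ^ m₁) ^ (m₂ / m₁) := by
  set S := ∑' i, c i ^ m₁ with hS
  calc ∑' i, c i ^ m₂ ≤ ∑' i, c i ^ m₁ * S ^ ((m₂ - m₁) / m₁) := by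
        refine ENNReal.tsum_le_tsum fun i => ?_
        calc c i ^ m₂ = c i ^ m₁ * c i ^ (m₂ - m₁) := by
              rw [← ENNReal.rpow_add_of_nonneg _ _ h₁.le (sub_nonneg.2 h₂)]; congr 1; ring
          _ ≤ c i ^ m₁ * (S ^ (1 / m₁)) ^ (m₂ - m₁) :=
              mul_le_mul_right (ENNReal.rpow_le_rpow (le_tsum_rpow c h₁ i) (sub_nonneg.2 h₂)) _
          _ = _ := by rw [← ENNReal.rpow_mul]; congr 2; ring
    _ = S ^ (1 : ℝ) * S ^ ((m₂ - m₁) / m₁) := by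
        rw [ENNReal.tsum_mul_right, ENNReal.rpow_one]
    _ = _ := by
        rw [← ENNReal.rpow_add_of_nonneg _ _ zero_le_one
          (div_nonneg (sub_nonneg.2 h₂) h₁.le)]
        congr 1; field_simp; ring

/-- Absorbs the linear growth of `b_{B_l} - b_{B_k}` into half of the exponential decay. -/
theorem one_add_mul_p_rpow_le {ε : ℝ} (hε : 0 < ε) : ∃ C : ℝ, 0 < C ∧ ∀ t : ℝ, 0 ≤ t →
    (1 + t) * (p : ℝ) ^ (-(ε * t)) ≤ C * (p : ℝ) ^ (-(ε / 2 * t)) := by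
  have hlog : 0 < Real.log p := Real.log_pos (one_lt_p p)
  have hκ : 0 < ε / 2 * Real.log p := by positivity
  refine ⟨1 + (ε / 2 * Real.log p)⁻¹, by positivity, fun t ht => ?_⟩
  have h1 : 1 + t ≤ (1 + (ε / 2 * Real.log p)⁻¹) * (p : ℝ) ^ (ε / 2 * t) := by
    rw [Real.rpow_def_of_pos (p_pos p)]
    have h := Real.add_one_le_exp (Real.log p * (ε / 2 * t))
    have h2 : t = (ε / 2 * Real.log p)⁻¹ * (Real.log p * (ε / 2 * t)) := by
      field_simp
    have h3 : 1 ≤ Real.exp (Real.log p * (ε / 2 * t)) := Real.one_le_exp (by positivity)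
    have h4 : (ε / 2 * Real.log p)⁻¹ * (Real.log p * (ε / 2 * t)) ≤
        (ε / 2 * Real.log p)⁻¹ * Real.exp (Real.log p * (ε / 2 * t)) :=
      mul_le_mul_of_nonneg_left (by linarith) (by positivity)
    linarith
  calc (1 + t) * (p : ℝ) ^ (-(ε * t))
      ≤ ((1 + (ε / 2 * Real.log p)⁻¹) * (p : ℝ) ^ (ε / 2 * t)) * (p : ℝ) ^ (-(ε * t)) :=
        mul_le_mul_of_nonneg_right h1 (Real.rpow_nonneg (p_pos p).le _)
    _ = _ := by rw [mul_assoc, ← Real.rpow_add (p_pos p)]; congr 2; ring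

/-- The two-valued sequence equal to `c₀` at negative and to `c₁` at nonnegative indices. -/
def signSeq (c₀ c₁ : ℝ) (l : ℤ) : ℝ := if l < 0 then c₀ else c₁

/-- The function `l ↦ l c_l` is piecewise linear and vanishes at `0`, so the change of slope causes
no jump and the smaller slope bounds every increment. -/
theorem signSeq_growth {c₀ c₁ δ : ℝ} (h₀ : δ ≤ c₀) (h₁ : δ ≤ c₁) {j k : ℤ} (hjk : j ≤ k) :
    δ * ((k : ℝ) - j) ≤ k * signSeq c₀ c₁ k - j * signSeq c₀ c₁ j := by
  have hjk' : (j : ℝ) ≤ k := by exact_mod_cast hjk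
  unfold signSeq
  split_ifs with hk hj hj
  · nlinarith
  · omega
  · have hj' : (j : ℝ) ≤ 0 := by exact_mod_cast hj.le
    have hk' : (0 : ℝ) ≤ k := by exact_mod_cast not_lt.1 hk
    nlinarith
  · nlinarith

/-! ### Norms of characteristic functions of balls -/

/-- On `S_l` with `l ≤ k`, growth of `D` and `w ≥ 1` give `D_k w ≥ l n - K + δ(k - l)`. Hence
`p^(-D_k w) |S_l|` is at most `p^K p^(-δ(k-l))`, a geometric series in `l`. -/
theorem lpNorm_indicator_ballB_le (hn : n ≠ 0) {w : Qpn p n → ℝ} {D : ℤ → ℝ} {δ K : ℝ}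
    (hδ : 0 < δ) (hw : ∀ᵐ x ∂haar p n, 1 ≤ w x)
    (hD : ∀ j k : ℤ, j ≤ k → δ * ((k : ℝ) - j) ≤ D k - D j)
    (hK : ∀ᵐ x ∂haar p n, ∀ l : ℤ, x ∈ sphereS p n l → l * n - D l * w x ≤ K) :
    ∃ C : ℝ≥0∞, C ≠ ∞ ∧ ∀ k : ℤ,
      lpNorm w ((ballB (0 : Qpn p n) k).indicator fun _ => (1 : ℝ)) ≤ C * (p : ℝ≥0∞) ^ D k := by
  set G := ∑' k : ℤ, (p : ℝ≥0∞) ^ (-(δ * |(k : ℝ)|)) with hG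
  have hGt : G ≠ ∞ := tsum_geometric_int_ne_top hδ
  have hKp : 0 < (p : ℝ) ^ K := Real.rpow_pos_of_pos (p_pos p) _
  -- `A ≥ 1` gives `A^(-w) ≤ A⁻¹`, and `A ≥ p^K G` then brings the summed modular down to `1`.
  set A : ℝ := max 1 ((p : ℝ) ^ K * G.toReal) with hA
  have hA1 : 1 ≤ A := le_max_left _ _
  have hA0 : 0 < A := zero_lt_one.trans_le hA1
  refine ⟨ENNReal.ofReal A, ENNReal.ofReal_ne_top, fun k => ?_⟩
  rw [← ofReal_p_rpow, ← ENNReal.ofReal_mul hA0.le]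
  have hDk : 0 < (p : ℝ) ^ D k := Real.rpow_pos_of_pos (p_pos p) _
  refine lpNorm_le_of_modular_le (by positivity) ?_
  rw [modular, lintegral_eq_tsum_sphereS hn]
  have hbound : ∀ l : ℤ, ∫⁻ x in sphereS p n l, ENNReal.ofReal
      (|(ballB (0 : Qpn p n) k).indicator (fun _ => (1 : ℝ)) x / (A * (p : ℝ) ^ D k)| ^ w x)
        ∂haar p n ≤ ENNReal.ofReal (A⁻¹ * (p : ℝ) ^ K) * (p : ℝ≥0∞) ^ (-(δ * |(k : ℝ) - l|)) := by
    intro l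
    calc _ ≤ ∫⁻ x in sphereS p n l, ENNReal.ofReal (A⁻¹ * (p : ℝ) ^ K) *
          (p : ℝ≥0∞) ^ (-(δ * |(k : ℝ) - l|)) * (p : ℝ≥0∞) ^ (-((l : ℝ) * n)) ∂haar p n := by
          refine lintegral_mono_ae ((ae_restrict_iff' (measurableSet_sphereS l)).2 ?_)
          filter_upwards [hw, hK] with x hx hxK hxl
          by_cases hxk : x ∈ ballB (0 : Qpn p n) k
          swap
          · simp [hxk, Real.zero_rpow (zero_lt_one.trans_le hx).ne']
          have hlk : l ≤ k := by
            rw [mem_ballB_zero, show ‖x‖ = (p : ℝ) ^ l from hxl,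
              zpow_le_zpow_iff_right₀ (one_lt_p p)] at hxk
            exact hxk
          have hlk' : (l : ℝ) ≤ k := by exact_mod_cast hlk
          rw [← ofReal_p_rpow, ← ofReal_p_rpow, ← ENNReal.ofReal_mul (by positivity),
            ← ENNReal.ofReal_mul (by positivity)]
          refine ENNReal.ofReal_le_ofReal ?_
          rw [Set.indicator_of_mem hxk, abs_of_pos (by positivity), one_div, mul_inv,
            Real.mul_rpow (by positivity) (by positivity), mul_assoc, mul_assoc]
          refine mul_le_mul ?_ ?_ (by positivity) (by positivity)
          · calc (A⁻¹) ^ w x ≤ (A⁻¹) ^ (1 : ℝ) :=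
                Real.rpow_le_rpow_of_exponent_ge (by positivity) (inv_le_one_of_one_le₀ hA1) hx
              _ = A⁻¹ := Real.rpow_one _
          · rw [← Real.rpow_neg (p_pos p).le, ← Real.rpow_mul (p_pos p).le,
              ← Real.rpow_add (p_pos p), ← Real.rpow_add (p_pos p)]
            refine Real.rpow_le_rpow_of_exponent_le (one_lt_p p).le ?_
            have h1 := hD l k hlk
            have h2 := hxK l hxl
            rw [abs_of_nonneg (by linarith)]
            have h3 : 0 ≤ δ * ((k : ℝ) - l) := mul_nonneg hδ.le (by linarith)
            nlinarith [mul_le_mul_of_nonneg_right h1 (zero_le_one.trans hx),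
              mul_le_mul_of_nonneg_left hx h3]
      _ = ENNReal.ofReal (A⁻¹ * (p : ℝ) ^ K) * (p : ℝ≥0∞) ^ (-(δ * |(k : ℝ) - l|)) *
          (p : ℝ≥0∞) ^ (-((l : ℝ) * n)) * haar p n (sphereS p n l) := by
          rw [setLIntegral_const]
      _ ≤ ENNReal.ofReal (A⁻¹ * (p : ℝ) ^ K) * (p : ℝ≥0∞) ^ (-(δ * |(k : ℝ) - l|)) *
          (p : ℝ≥0∞) ^ (-((l : ℝ) * n)) * (p : ℝ≥0∞) ^ ((l : ℝ) * n) :=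
          mul_le_mul_right (haar_sphereS_le l) _
      _ = _ := by rw [mul_assoc _ ((p : ℝ≥0∞) ^ (-((l : ℝ) * n))), ← p_rpow_add]; simp
  calc _ ≤ ∑' l : ℤ, ENNReal.ofReal (A⁻¹ * (p : ℝ) ^ K) *
        (p : ℝ≥0∞) ^ (-(δ * |(k : ℝ) - l|)) := ENNReal.tsum_le_tsum hbound
    _ = ENNReal.ofReal (A⁻¹ * (p : ℝ) ^ K) * ENNReal.ofReal G.toReal := by
        rw [ENNReal.tsum_mul_left, tsum_geometric_sub, ENNReal.ofReal_toReal hGt]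
    _ ≤ 1 := by
        rw [← ENNReal.ofReal_mul (by positivity), ← ENNReal.ofReal_one]
        refine ENNReal.ofReal_le_ofReal ?_
        rw [mul_assoc, inv_mul_le_one₀ hA0]
        exact le_max_right _ _

/-! ### Mean oscillation -/

theorem setLIntegral_mul_le {u f g : Qpn p n → ℝ} {s t : Set (Qpn p n)} (hs : MeasurableSet s)
    (hst : s ⊆ t) (hum : Measurable u) (hu : ∀ᵐ x ∂haar p n, 1 < u x)
    (hf : AEMeasurable (s.indicator f) (haar p n)) (hfin : lpNorm u (s.indicator f) < ∞)
    (hgin : lpNorm (conjExp u) (t.indicator g) < ∞) :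
    ∫⁻ x in s, ENNReal.ofReal (|f x| * |g x|) ∂haar p n
      ≤ 2 * lpNorm u (s.indicator f) * lpNorm (conjExp u) (t.indicator g) := by
  refine le_trans ?_ (lintegral_abs_mul_le hum hu hf hfin hgin)
  rw [← lintegral_indicator hs]
  refine lintegral_mono fun x => ?_
  by_cases hx : x ∈ s
  · rw [Set.indicator_of_mem hx, Set.indicator_of_mem hx, Set.indicator_of_mem (hst hx)]
  · simp [hx]

theorem haar_ballB_ne_top (k : ℤ) : haar p n (ballB 0 k) ≠ ∞ := by
  rw [haar_ballB_zero]; exact p_rpow_ne_top _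

theorem haar_ballB_ne_zero (k : ℤ) : haar p n (ballB 0 k) ≠ 0 := by
  rw [haar_ballB_zero]; exact p_rpow_ne_zero _

/-- Hölder with `v, v'` bounds the average of `|b - b_{B_k}|` over `B_k`, because the exponents
`D_k` and `k n - D_k` add up to that of `|B_k|`. Consecutive means thus differ by a constant
containing `|B_{k+1}|/|B_k| = p^n`, and the differences telescope. -/
theorem mean_sub_le {v b : Qpn p n → ℝ} (hvm : Measurable v) (hv : ∀ᵐ x ∂haar p n, 1 < v x)
    (hb : AEMeasurable b (haar p n)) {D : ℤ → ℝ} {C : ℝ≥0∞} (hC : C ≠ ∞)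
    (hosc : ∀ k, lpNorm v ((ballB (0 : Qpn p n) k).indicator fun x => b x - mean b k)
      ≤ C * (p : ℝ≥0∞) ^ D k)
    (hchi : ∀ k : ℤ, lpNorm (conjExp v) ((ballB (0 : Qpn p n) k).indicator fun _ => (1 : ℝ))
      ≤ C * (p : ℝ≥0∞) ^ (k * n - D k)) :
    ∃ A : ℝ, 0 ≤ A ∧ ∀ k l : ℤ, |mean b l - mean b k| ≤ A * |(l : ℝ) - k| := by
  have hosc' : ∀ k : ℤ, ∫⁻ x in ballB 0 k, ‖b x - mean b k‖ₑ ∂haar p n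
      ≤ 2 * C * C * (p : ℝ≥0∞) ^ ((k : ℝ) * n) := by
    intro k
    have hfin : ∀ x : ℝ, C * (p : ℝ≥0∞) ^ x < ∞ := fun x =>
      (ENNReal.mul_ne_top hC (p_rpow_ne_top x)).lt_top
    have h := setLIntegral_mul_le (u := v) (f := fun x => b x - mean b k) (g := fun _ => (1 : ℝ))
      (measurableSet_ballB 0 k) subset_rfl hvm hv
      ((hb.sub_const _).indicator (measurableSet_ballB 0 k))
      ((hosc k).trans_lt (hfin _)) ((hchi k).trans_lt (hfin _))
    calc _ = ∫⁻ x in ballB 0 k, ENNReal.ofReal (|b x - mean b k| * |(1 : ℝ)|) ∂haar p n := by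
          simp [Real.enorm_eq_ofReal_abs]
      _ ≤ _ := h
      _ ≤ 2 * (C * (p : ℝ≥0∞) ^ D k) * (C * (p : ℝ≥0∞) ^ (k * n - D k)) := by
          gcongr
          · exact hosc k
          · exact hchi k
      _ = 2 * C * C * ((p : ℝ≥0∞) ^ D k * (p : ℝ≥0∞) ^ (k * n - D k)) := by ring
      _ = _ := by rw [← p_rpow_add]; congr 2; ring
  have hfin : 2 * C * C * (p : ℝ≥0∞) ^ (n : ℝ) ≠ ∞ :=
    ENNReal.mul_ne_top (ENNReal.mul_ne_top (ENNReal.mul_ne_top ENNReal.ofNat_ne_top hC) hC)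
      (p_rpow_ne_top _)
  set A := (2 * C * C * (p : ℝ≥0∞) ^ (n : ℝ)).toReal with hA
  have hA0 : 0 ≤ A := ENNReal.toReal_nonneg
  have hstep : ∀ k : ℤ, |mean b (k + 1) - mean b k| ≤ A := by
    intro k
    have hint : IntegrableOn (fun x => b x - mean b (k + 1)) (ballB 0 (k + 1)) (haar p n) := by
      refine ⟨(hb.sub_const _).aestronglyMeasurable.restrict, (hosc' (k + 1)).trans_lt ?_⟩
      exact (ENNReal.mul_ne_top (ENNReal.mul_ne_top (ENNReal.mul_ne_top ENNReal.ofNat_ne_top hC) hC)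
        (p_rpow_ne_top _)).lt_top
    have hint' := hint.mono_set
      (ballB_subset_ballB (p := p) (n := n) (Int.le_add_one le_rfl : k ≤ k + 1))
    have hvol0 : (haar p n).real (ballB 0 k) ≠ 0 :=
      (ENNReal.toReal_pos (haar_ballB_ne_zero k) (haar_ballB_ne_top k)).ne'
    have hconst : IntegrableOn (fun _ : Qpn p n => mean b (k + 1)) (ballB 0 k) (haar p n) :=
      integrableOn_const (haar_ballB_ne_top k)
    have e : mean b k - mean b (k + 1) = ((haar p n).real (ballB 0 k))⁻¹ *
        ∫ x in ballB 0 k, (b x - mean b (k + 1)) ∂haar p n := by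
      have hb' : ∫ x in ballB 0 k, b x ∂haar p n = ∫ x in ballB 0 k,
          (b x - mean b (k + 1)) ∂haar p n + (haar p n).real (ballB 0 k) * mean b (k + 1) := by
        have := integral_add hint' hconst
        simp only [sub_add_cancel] at this
        rw [this, setIntegral_const, smul_eq_mul]
      conv_lhs => rw [mean]
      rw [setAverage_eq, smul_eq_mul, hb']
      field_simp
      ring
    have hle : ENNReal.ofReal |mean b (k + 1) - mean b k|
        ≤ 2 * C * C * (p : ℝ≥0∞) ^ (n : ℝ) := by
      rw [abs_sub_comm, e, ← Real.enorm_eq_ofReal_abs, enorm_mul]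
      calc _ ≤ ((p : ℝ≥0∞) ^ ((k : ℝ) * n))⁻¹ *
            (2 * C * C * (p : ℝ≥0∞) ^ (((k + 1 : ℤ) : ℝ) * n)) := by
            refine mul_le_mul' (le_of_eq ?_) ((enorm_integral_le_lintegral_enorm _).trans
              ((lintegral_mono_set (ballB_subset_ballB (Int.le_add_one le_rfl))).trans
                (hosc' (k + 1))))
            rw [enorm_inv hvol0, ← haar_ballB_zero, Real.enorm_eq_ofReal measureReal_nonneg,
              measureReal_def, ENNReal.ofReal_toReal (haar_ballB_ne_top k)]
        _ = 2 * C * C * (((p : ℝ≥0∞) ^ ((k : ℝ) * n))⁻¹ *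
            (p : ℝ≥0∞) ^ (((k + 1 : ℤ) : ℝ) * n)) := by ring
        _ = _ := by rw [← ENNReal.rpow_neg, ← p_rpow_add]; congr 2; push_cast; ring
    exact (ENNReal.ofReal_le_iff_le_toReal hfin).1 hle
  have hnat : ∀ (k : ℤ) (i : ℕ), |mean b (k + i) - mean b k| ≤ A * i := by
    intro k i
    induction i with
    | zero => simp
    | succ i ih =>
      have h := abs_sub_le (mean b (k + (i + 1 : ℕ))) (mean b (k + i)) (mean b k)
      have h2 := hstep (k + i)
      rw [show k + (i : ℤ) + 1 = k + (i + 1 : ℕ) by push_cast; ring] at h2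
      push_cast at h h2 ⊢
      linarith
  refine ⟨A, hA0, fun k l => ?_⟩
  rcases le_total k l with h | h
  · obtain ⟨i, rfl⟩ : ∃ i : ℕ, l = k + i := ⟨(l - k).toNat, by omega⟩
    simpa using hnat k i
  · obtain ⟨i, rfl⟩ : ∃ i : ℕ, k = l + i := ⟨(k - l).toNat, by omega⟩
    rw [abs_sub_comm]
    simpa using hnat l i

/-! ### The dominating integral -/

/-- The integral of `|f| (1 + |b - b_{B_l}|)` against the kernel `max(p^l, |t|)^{α-n}`; up to a
factor depending on `b` it dominates both commutators on the sphere `S_l`. -/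
def kernelIntegral (α : ℝ) (b f : Qpn p n → ℝ) (l : ℤ) : ℝ≥0∞ :=
  ∫⁻ t, ENNReal.ofReal
    (|f t| * (1 + |b t - mean b l|) / (max ((p : ℝ) ^ l) ‖t‖) ^ ((n : ℝ) - α)) ∂haar p n

/-- Size and oscillation bounds on balls for the exponents `v` and `u'` and the symbol `b`. -/
structure BallBounds (α : ℝ) (u v b : Qpn p n → ℝ) (D : ℤ → ℝ) (C : ℝ) : Prop where
  nonneg : 0 ≤ C
  aemeasurable : AEMeasurable b (haar p n)
  mean_sub : ∀ k l : ℤ, |mean b l - mean b k| ≤ C * |(l : ℝ) - k|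
  chi_v : ∀ k : ℤ, lpNorm v ((ballB (0 : Qpn p n) k).indicator fun _ => (1 : ℝ))
    ≤ ENNReal.ofReal C * (p : ℝ≥0∞) ^ D k
  osc_v : ∀ k : ℤ, lpNorm v ((ballB (0 : Qpn p n) k).indicator fun x => b x - mean b k)
    ≤ ENNReal.ofReal C * (p : ℝ≥0∞) ^ D k
  chi_u : ∀ k : ℤ, lpNorm (conjExp u) ((ballB (0 : Qpn p n) k).indicator fun _ => (1 : ℝ))
    ≤ ENNReal.ofReal C * (p : ℝ≥0∞) ^ ((k : ℝ) * (n - α) - D k)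
  osc_u : ∀ k : ℤ, lpNorm (conjExp u) ((ballB (0 : Qpn p n) k).indicator fun x => b x - mean b k)
    ≤ ENNReal.ofReal C * (p : ℝ≥0∞) ^ ((k : ℝ) * (n - α) - D k)

theorem MemLpVarLoc.sphereS {u f : Qpn p n → ℝ} (hf : MemLpVarLoc u f) (k : ℤ) :
    MemLpVar u ((sphereS p n k).indicator f) := hf _ (isCompact_sphereS k)

theorem MemLpVarLoc.aemeasurable {u f : Qpn p n → ℝ} (hf : MemLpVarLoc u f) :
    AEMeasurable f (haar p n) := by
  have hU : ⋃ k : ℤ, ballB (0 : Qpn p n) k = Set.univ := by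
    refine Set.eq_univ_of_forall fun x => Set.mem_iUnion.2 ?_
    by_cases hx : x = 0
    · exact ⟨0, by rw [mem_ballB_zero, hx]; simp⟩
    · obtain ⟨l, hl⟩ := exists_mem_sphereS hx
      exact ⟨l, sphereS_subset_ballB le_rfl hl⟩
  rw [← Measure.restrict_univ (μ := haar p n), ← hU, aemeasurable_iUnion_iff]
  exact fun k => (aemeasurable_indicator_iff (measurableSet_ballB 0 k)).1
    (hf _ (isCompact_ballB 0 k)).1

variable {α : ℝ} {u v b f : Qpn p n → ℝ} {D : ℤ → ℝ} {C : ℝ}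

/-- Recentring `b` from `b_{B_l}` to `b_{B_k}` costs `C|l - k|`; then Hölder pairs `f χ_{S_k}` with
`1` and with `b - b_{B_k}` on `B_k`. -/
theorem BallBounds.setLIntegral_sphereS_le (hB : BallBounds α u v b D C) (hum : Measurable u)
    (hu : ∀ᵐ x ∂haar p n, 1 < u x) (hf : MemLpVarLoc u f) (l k : ℤ) :
    ∫⁻ t in sphereS p n k, ENNReal.ofReal (|f t| * (1 + |b t - mean b l|)) ∂haar p n
      ≤ ENNReal.ofReal (2 * C * (2 + C) * (1 + |(l : ℝ) - k|)) *
        (p : ℝ≥0∞) ^ ((k : ℝ) * (n - α) - D k) * lpNorm u ((sphereS p n k).indicator f) := by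
  have hC := hB.nonneg
  set X := (p : ℝ≥0∞) ^ ((k : ℝ) * (n - α) - D k) with hX
  set a := lpNorm u ((sphereS p n k).indicator f) with ha
  have hfin : ENNReal.ofReal C * X < ∞ :=
    (ENNReal.mul_ne_top ENNReal.ofReal_ne_top (p_rpow_ne_top _)).lt_top
  have h1 := setLIntegral_mul_le (g := fun _ => (1 : ℝ)) (measurableSet_sphereS k)
    (sphereS_subset_ballB le_rfl) hum hu (hf.sphereS k).1 (hf.sphereS k).2
    ((hB.chi_u k).trans_lt hfin)
  have h2 := setLIntegral_mul_le (g := fun x => b x - mean b k) (measurableSet_sphereS k)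
    (sphereS_subset_ballB le_rfl) hum hu (hf.sphereS k).1 (hf.sphereS k).2
    ((hB.osc_u k).trans_lt hfin)
  rw [← ha] at h1 h2
  have hfm : AEMeasurable f ((haar p n).restrict (sphereS p n k)) := hf.aemeasurable.restrict
  have hM : 0 ≤ 1 + C * |(l : ℝ) - k| := by positivity
  calc ∫⁻ t in sphereS p n k, ENNReal.ofReal (|f t| * (1 + |b t - mean b l|)) ∂haar p n
      ≤ ∫⁻ t in sphereS p n k, (ENNReal.ofReal (1 + C * |(l : ℝ) - k|) *
          ENNReal.ofReal (|f t| * |(1 : ℝ)|) +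
          ENNReal.ofReal (|f t| * |b t - mean b k|)) ∂haar p n := by
        refine lintegral_mono fun t => ?_
        rw [← ENNReal.ofReal_mul hM, ← ENNReal.ofReal_add (by positivity) (by positivity)]
        refine ENNReal.ofReal_le_ofReal ?_
        have h3 : |b t - mean b l| ≤ |b t - mean b k| + C * |(l : ℝ) - k| :=
          (abs_sub_le _ (mean b k) _).trans (by
            rw [abs_sub_comm (mean b k)]; linarith [hB.mean_sub k l])
        rw [abs_one, mul_one]
        nlinarith [mul_le_mul_of_nonneg_left h3 (abs_nonneg (f t))]
    _ = ENNReal.ofReal (1 + C * |(l : ℝ) - k|) *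
          ∫⁻ t in sphereS p n k, ENNReal.ofReal (|f t| * |(1 : ℝ)|) ∂haar p n +
          ∫⁻ t in sphereS p n k, ENNReal.ofReal (|f t| * |b t - mean b k|) ∂haar p n := by
        rw [lintegral_add_left', lintegral_const_mul' _ _ ENNReal.ofReal_ne_top]
        exact ((hfm.abs.mul_const _).ennreal_ofReal).const_mul _
    _ ≤ ENNReal.ofReal (1 + C * |(l : ℝ) - k|) * (2 * a * (ENNReal.ofReal C * X)) +
          2 * a * (ENNReal.ofReal C * X) := by
        refine add_le_add (mul_le_mul_right (h1.trans (mul_le_mul_right (hB.chi_u k) _)) _)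
          (h2.trans (mul_le_mul_right (hB.osc_u k) _))
    _ = ENNReal.ofReal (1 + C * |(l : ℝ) - k| + 1) * ENNReal.ofReal 2 * ENNReal.ofReal C *
          X * a := by
        rw [ENNReal.ofReal_add hM zero_le_one, ENNReal.ofReal_one, ENNReal.ofReal_ofNat]; ring
    _ ≤ _ := by
        rw [← ENNReal.ofReal_mul (by positivity), ← ENNReal.ofReal_mul (by positivity)]
        gcongr ENNReal.ofReal ?_ * _ * _
        have := abs_nonneg ((l : ℝ) - k)
        nlinarith [mul_nonneg hC this, mul_nonneg hC hC, mul_nonneg (mul_nonneg hC hC) this]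

theorem BallBounds.kernelIntegral_le (hn : n ≠ 0) (hB : BallBounds α u v b D C)
    (hum : Measurable u) (hu : ∀ᵐ x ∂haar p n, 1 < u x) (hf : MemLpVarLoc u f) (l : ℤ) :
    kernelIntegral α b f l ≤ ∑' k : ℤ, ENNReal.ofReal (2 * C * (2 + C) * (1 + |(l : ℝ) - k|)) *
      (p : ℝ≥0∞) ^ (-(((n : ℝ) - α) * max (l : ℝ) k) + ((k : ℝ) * (n - α) - D k)) *
        lpNorm u ((sphereS p n k).indicator f) := by
  rw [kernelIntegral, lintegral_eq_tsum_sphereS hn]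
  refine ENNReal.tsum_le_tsum fun k => ?_
  have e : ∫⁻ t in sphereS p n k, ENNReal.ofReal (|f t| * (1 + |b t - mean b l|) /
      (max ((p : ℝ) ^ l) ‖t‖) ^ ((n : ℝ) - α)) ∂haar p n =
      (p : ℝ≥0∞) ^ (-(((n : ℝ) - α) * max (l : ℝ) k)) *
      ∫⁻ t in sphereS p n k, ENNReal.ofReal (|f t| * (1 + |b t - mean b l|)) ∂haar p n := by
    rw [← lintegral_const_mul' _ _ (p_rpow_ne_top _)]
    refine setLIntegral_congr_fun (measurableSet_sphereS k) fun t ht => ?_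
    have ht' : ‖t‖ = (p : ℝ) ^ k := ht
    rw [← ofReal_p_rpow, ← ENNReal.ofReal_mul (Real.rpow_nonneg (p_pos p).le _)]
    congr 1
    have hmax : max ((p : ℝ) ^ l) ‖t‖ = (p : ℝ) ^ (max (l : ℝ) k) := by
      rw [ht']
      rcases le_total l k with h | h
      · rw [max_eq_right (zpow_le_zpow_right₀ (one_lt_p p).le h),
          max_eq_right (by exact_mod_cast h), Real.rpow_intCast]
      · rw [max_eq_left (zpow_le_zpow_right₀ (one_lt_p p).le h),
          max_eq_left (by exact_mod_cast h), Real.rpow_intCast]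
    rw [hmax, ← Real.rpow_mul (p_pos p).le, Real.rpow_neg (p_pos p).le, div_eq_inv_mul,
      mul_comm (max (l : ℝ) k)]
  rw [e]
  refine (mul_le_mul_right (hB.setLIntegral_sphereS_le hum hu hf l k) _).trans (le_of_eq ?_)
  rw [p_rpow_add]; ring

theorem signSeq_add (a₀ a₁ c₀ c₁ : ℝ) (l : ℤ) :
    signSeq (a₀ + c₀) (a₁ + c₁) l = signSeq a₀ a₁ l + signSeq c₀ c₁ l := by
  unfold signSeq; split_ifs <;> rfl

theorem signSeq_const_sub (s c₀ c₁ : ℝ) (l : ℤ) :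
    signSeq (s - c₀) (s - c₁) l = s - signSeq c₀ c₁ l := by
  unfold signSeq; split_ifs <;> rfl

/-- The slopes `d + β` lie between `δ` and `n - α - δ`, so the off-diagonal terms decay on both
sides. The weight may have different slopes at negative and nonnegative indices: `β` everywhere
gives the Herz bound, while slope `0` near the origin gives local integrability. -/
theorem BallBounds.weighted_kernelIntegral_le (hn : n ≠ 0) {d₀ d₁ β₀ β₁ δ : ℝ} (hδ : 0 < δ)
    (hB : BallBounds α u v b (fun l => l * signSeq d₀ d₁ l) C)
    (hum : Measurable u) (hu : ∀ᵐ x ∂haar p n, 1 < u x)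
    (h₀ : δ ≤ d₀ + β₀) (h₁ : δ ≤ d₁ + β₁) (h₀' : δ ≤ n - α - (d₀ + β₀))
    (h₁' : δ ≤ n - α - (d₁ + β₁)) :
    ∃ C' : ℝ≥0∞, C' ≠ ∞ ∧ ∀ f : Qpn p n → ℝ, MemLpVarLoc u f → ∀ l : ℤ,
      (p : ℝ≥0∞) ^ (l * signSeq β₀ β₁ l) * ((p : ℝ≥0∞) ^ (l * signSeq d₀ d₁ l) *
        kernelIntegral α b f l) ≤ C' * ∑' k : ℤ, (p : ℝ≥0∞) ^ (-(δ / 2 * |(l : ℝ) - k|)) *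
          ((p : ℝ≥0∞) ^ (k * signSeq β₀ β₁ k) * lpNorm u ((sphereS p n k).indicator f)) := by
  obtain ⟨A, hA, hAle⟩ := one_add_mul_p_rpow_le (p := p) hδ
  have hC := hB.nonneg
  refine ⟨ENNReal.ofReal (2 * C * (2 + C) * A), ENNReal.ofReal_ne_top, fun f hf l => ?_⟩
  rw [← mul_assoc, ← p_rpow_add, ← ENNReal.tsum_mul_left]
  refine (mul_le_mul_right (hB.kernelIntegral_le hn hum hu hf l) _).trans ?_
  rw [← ENNReal.tsum_mul_left]
  refine ENNReal.tsum_le_tsum fun k => ?_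
  set a := lpNorm u ((PadicHerz.sphereS p n k).indicator f)
  -- For `l ≤ k` the kernel power cancels `k(n-α)` and growth of `l(d_l + β_l)` suffices; for `k ≤
  -- l` a factor `p^(-(n-α)(l-k))` is left, and growth of `l(n - α - d_l - β_l)` is what is needed.
  have hexp : (l : ℝ) * signSeq β₀ β₁ l + l * signSeq d₀ d₁ l +
      (-(((n : ℝ) - α) * max (l : ℝ) k) + ((k : ℝ) * (n - α) - k * signSeq d₀ d₁ k))
      ≤ -(δ * |(l : ℝ) - k|) + k * signSeq β₀ β₁ k := by
    rcases le_total l k with h | h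
    · have g := signSeq_growth h₀ h₁ h
      have h' : (l : ℝ) ≤ k := by exact_mod_cast h
      rw [max_eq_right h', abs_of_nonpos (by linarith)]
      simp only [signSeq_add] at g
      linarith
    · have g := signSeq_growth h₀' h₁' h
      have h' : (k : ℝ) ≤ l := by exact_mod_cast h
      rw [max_eq_left h', abs_of_nonneg (by linarith)]
      simp only [signSeq_const_sub, signSeq_add] at g
      linarith
  calc (p : ℝ≥0∞) ^ ((l : ℝ) * signSeq β₀ β₁ l + l * signSeq d₀ d₁ l) *
        (ENNReal.ofReal (2 * C * (2 + C) * (1 + |(l : ℝ) - k|)) *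
        (p : ℝ≥0∞) ^ (-(((n : ℝ) - α) * max (l : ℝ) k) +
          ((k : ℝ) * (n - α) - k * signSeq d₀ d₁ k)) * a)
      = ENNReal.ofReal (2 * C * (2 + C) * (1 + |(l : ℝ) - k|)) *
        (p : ℝ≥0∞) ^ ((l : ℝ) * signSeq β₀ β₁ l + l * signSeq d₀ d₁ l +
        (-(((n : ℝ) - α) * max (l : ℝ) k) + ((k : ℝ) * (n - α) - k * signSeq d₀ d₁ k))) * a := by
        rw [p_rpow_add (_ + _) (_ + _)]; ring
    _ ≤ ENNReal.ofReal (2 * C * (2 + C) * (1 + |(l : ℝ) - k|)) *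
        (p : ℝ≥0∞) ^ (-(δ * |(l : ℝ) - k|) + k * signSeq β₀ β₁ k) * a := by
        gcongr _ * ?_ * _
        exact p_rpow_mono hexp
    _ = ENNReal.ofReal (2 * C * (2 + C) * ((1 + |(l : ℝ) - k|) *
        (p : ℝ) ^ (-(δ * |(l : ℝ) - k|)))) * ((p : ℝ≥0∞) ^ (k * signSeq β₀ β₁ k) * a) := by
        rw [p_rpow_add, ← ofReal_p_rpow (-(δ * |(l : ℝ) - k|)),
          ← mul_assoc (2 * C * (2 + C)) (1 + |(l : ℝ) - k|),
          ENNReal.ofReal_mul (p := 2 * C * (2 + C) * (1 + |(l : ℝ) - k|)) (by positivity)]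
        ring
    _ ≤ ENNReal.ofReal (2 * C * (2 + C) * (A * (p : ℝ) ^ (-(δ / 2 * |(l : ℝ) - k|)))) *
        ((p : ℝ≥0∞) ^ (k * signSeq β₀ β₁ k) * a) := by
        gcongr ENNReal.ofReal ?_ * _
        exact mul_le_mul_of_nonneg_left (hAle _ (abs_nonneg _)) (by positivity)
    _ = _ := by
        rw [← mul_assoc (2 * C * (2 + C)) A,
          ENNReal.ofReal_mul (p := 2 * C * (2 + C) * A) (by positivity), ofReal_p_rpow]
        ring

/-! ### Pointwise domination of the commutators -/

section Pointwise

variable {α : ℝ} {b f : Qpn p n → ℝ} {l : ℤ}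

theorem integrable_kernel (hb : AEMeasurable b (haar p n)) (hf : AEMeasurable f (haar p n))
    (hT : kernelIntegral α b f l ≠ ∞) :
    Integrable (fun t => |f t| * (1 + |b t - mean b l|) /
      (max ((p : ℝ) ^ l) ‖t‖) ^ ((n : ℝ) - α)) (haar p n) := by
  have hm : Measurable fun t : Qpn p n => (max ((p : ℝ) ^ l) ‖t‖) ^ ((n : ℝ) - α) :=
    (measurable_const.max measurable_norm).pow_const _
  have hmeas : AEMeasurable (fun t => |f t| * (1 + |b t - mean b l|) /
      (max ((p : ℝ) ^ l) ‖t‖) ^ ((n : ℝ) - α)) (haar p n) :=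
    (hf.abs.mul ((hb.sub_const _).abs.const_add 1)).div hm.aemeasurable
  refine ⟨hmeas.aestronglyMeasurable, ?_⟩
  rw [hasFiniteIntegral_iff_ofReal]
  · exact hT.lt_top
  · exact Eventually.of_forall fun t => by positivity

theorem integral_kernel (hb : AEMeasurable b (haar p n)) (hf : AEMeasurable f (haar p n))
    (hT : kernelIntegral α b f l ≠ ∞) :
    ∫ t, |f t| * (1 + |b t - mean b l|) / (max ((p : ℝ) ^ l) ‖t‖) ^ ((n : ℝ) - α) ∂haar p n
      = (kernelIntegral α b f l).toReal := by
  rw [integral_eq_lintegral_of_nonneg_ae (Eventually.of_forall fun t => by positivity)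
    (integrable_kernel hb hf hT).aestronglyMeasurable]
  rfl

/-- With `m = b_{B_l}`, the bound `|c - b(t)| ≤ (1 + |c - m|)(1 + |b(t) - m|)` separates the
variables. Taking `c = b(x)` gives the commutator at `x`; `c = 0` gives integrability of the term
with `b f`. -/
theorem commutator_bounds (hb : AEMeasurable b (haar p n)) (hf : AEMeasurable f (haar p n))
    (hT : kernelIntegral α b f l ≠ ∞) {s : Set (Qpn p n)} (hs : MeasurableSet s)
    {κ : Qpn p n → ℝ} (hκ : Measurable κ)
    (hκs : ∀ t ∈ s, |κ t| ≤ 1 / (max ((p : ℝ) ^ l) ‖t‖) ^ ((n : ℝ) - α)) :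
    IntegrableOn (fun t => κ t * f t) s (haar p n) ∧
    IntegrableOn (fun t => κ t * (b t * f t)) s (haar p n) ∧
    ∀ c : ℝ, |c * ∫ t in s, κ t * f t ∂haar p n - ∫ t in s, κ t * (b t * f t) ∂haar p n|
      ≤ (1 + |c - mean b l|) * (kernelIntegral α b f l).toReal := by
  set Φ : Qpn p n → ℝ := fun t => |f t| * (1 + |b t - mean b l|) /
      (max ((p : ℝ) ^ l) ‖t‖) ^ ((n : ℝ) - α) with hΦ
  have hI : Integrable Φ (haar p n) := integrable_kernel hb hf hT
  have hΦ0 : ∀ t, 0 ≤ Φ t := fun t => by positivity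
  have key : ∀ (c : ℝ) (t), t ∈ s →
      |(c - b t) * (κ t * f t)| ≤ (1 + |c - mean b l|) * Φ t := by
    intro c t ht
    have h1 : |c - b t| ≤ (1 + |c - mean b l|) * (1 + |b t - mean b l|) := by
      have h := abs_sub_le c (mean b l) (b t)
      rw [abs_sub_comm (mean b l)] at h
      nlinarith [abs_nonneg (c - mean b l), abs_nonneg (b t - mean b l),
        mul_nonneg (abs_nonneg (c - mean b l)) (abs_nonneg (b t - mean b l))]
    rw [abs_mul, abs_mul]
    calc |c - b t| * (|κ t| * |f t|)
        ≤ ((1 + |c - mean b l|) * (1 + |b t - mean b l|)) *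
          (1 / (max ((p : ℝ) ^ l) ‖t‖) ^ ((n : ℝ) - α) * |f t|) := by
          gcongr
          exact hκs t ht
      _ = _ := by rw [hΦ]; ring
  have i1 : IntegrableOn (fun t => κ t * f t) s (haar p n) := by
    refine hI.integrableOn.mono' (hκ.aemeasurable.mul hf).aestronglyMeasurable.restrict ?_
    refine (ae_restrict_iff' hs).2 (Eventually.of_forall fun t ht => ?_)
    rw [Real.norm_eq_abs, abs_mul]
    calc |κ t| * |f t| ≤ 1 / (max ((p : ℝ) ^ l) ‖t‖) ^ ((n : ℝ) - α) * |f t| * 1 := by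
          rw [mul_one]; gcongr; exact hκs t ht
      _ ≤ 1 / (max ((p : ℝ) ^ l) ‖t‖) ^ ((n : ℝ) - α) * |f t| * (1 + |b t - mean b l|) := by
          gcongr; linarith [abs_nonneg (b t - mean b l)]
      _ = Φ t := by rw [hΦ]; ring
  have i2 : IntegrableOn (fun t => κ t * (b t * f t)) s (haar p n) := by
    refine (hI.const_mul (1 + |0 - mean b l|)).integrableOn.mono'
      (hκ.aemeasurable.mul (hb.mul hf)).aestronglyMeasurable.restrict ?_
    refine (ae_restrict_iff' hs).2 (Eventually.of_forall fun t ht => ?_)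
    have e : |κ t * (b t * f t)| = |(0 - b t) * (κ t * f t)| := by
      rw [zero_sub, neg_mul, abs_neg]; congr 1; ring
    rw [Real.norm_eq_abs, e]
    exact key 0 t ht
  refine ⟨i1, i2, fun c => ?_⟩
  have e : c * ∫ t in s, κ t * f t ∂haar p n - ∫ t in s, κ t * (b t * f t) ∂haar p n =
      ∫ t in s, (c - b t) * (κ t * f t) ∂haar p n := by
    rw [← integral_const_mul, ← integral_sub (i1.const_mul c) i2]
    congr 1; ext t; ring
  rw [e, ← integral_kernel hb hf hT, ← integral_const_mul]
  refine (norm_integral_le_of_norm_le (hI.const_mul (1 + |c - mean b l|)).integrableOn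
    ((ae_restrict_iff' hs).2 (Eventually.of_forall fun t ht =>
      (Real.norm_eq_abs _).trans_le (key c t ht)))).trans ?_
  exact setIntegral_le_integral (hI.const_mul _)
    (Eventually.of_forall fun t => mul_nonneg (by positivity) (hΦ0 t))

theorem hardy_bounds (hb : AEMeasurable b (haar p n)) (hf : AEMeasurable f (haar p n))
    (hT : kernelIntegral α b f l ≠ ∞) {x : Qpn p n} (hx : x ∈ sphereS p n l) :
    IntegrableOn f {t : Qpn p n | ‖t‖ ≤ ‖x‖} (haar p n) ∧
    IntegrableOn (fun t => b t * f t) {t : Qpn p n | ‖t‖ ≤ ‖x‖} (haar p n) ∧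
    |hardyComm α b f x| ≤ (1 + |b x - mean b l|) * (kernelIntegral α b f l).toReal := by
  have hx' : ‖x‖ = (p : ℝ) ^ l := hx
  have hx0 : 0 < ‖x‖ := hx' ▸ zpow_pos (p_pos p) l
  have hκ0 : 0 < 1 / ‖x‖ ^ ((n : ℝ) - α) := by positivity
  obtain ⟨i1, i2, h⟩ := commutator_bounds hb hf hT
    (measurableSet_le measurable_norm measurable_const : MeasurableSet {t : Qpn p n | ‖t‖ ≤ ‖x‖})
    (measurable_const : Measurable fun _ => 1 / ‖x‖ ^ ((n : ℝ) - α)) (fun t ht => by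
      rw [abs_of_pos hκ0, ← hx', max_eq_left ht])
  have j1 := i1.const_mul (1 / ‖x‖ ^ ((n : ℝ) - α))⁻¹
  have j2 := i2.const_mul (1 / ‖x‖ ^ ((n : ℝ) - α))⁻¹
  simp only [inv_mul_cancel_left₀ hκ0.ne'] at j1 j2
  simp only [integral_const_mul] at h
  exact ⟨j1, j2, h (b x)⟩

theorem hardyAdj_bounds (hb : AEMeasurable b (haar p n)) (hf : AEMeasurable f (haar p n))
    (hT : kernelIntegral α b f l ≠ ∞) {x : Qpn p n} (hx : x ∈ sphereS p n l) :
    IntegrableOn (fun t => f t / ‖t‖ ^ ((n : ℝ) - α)) {t : Qpn p n | ‖x‖ < ‖t‖} (haar p n) ∧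
    IntegrableOn (fun t => b t * f t / ‖t‖ ^ ((n : ℝ) - α)) {t : Qpn p n | ‖x‖ < ‖t‖}
      (haar p n) ∧
    |hardyAdjComm α b f x| ≤ (1 + |b x - mean b l|) * (kernelIntegral α b f l).toReal := by
  have hx' : ‖x‖ = (p : ℝ) ^ l := hx
  obtain ⟨i1, i2, h⟩ := commutator_bounds hb hf hT
    (measurableSet_lt measurable_const measurable_norm : MeasurableSet {t : Qpn p n | ‖x‖ < ‖t‖})
    (κ := fun t => 1 / ‖t‖ ^ ((n : ℝ) - α)) (measurable_const.div (measurable_norm.pow_const _))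
    (fun t (ht : ‖x‖ < ‖t‖) => by
      rw [abs_of_nonneg (by positivity), ← hx', max_eq_right ht.le])
  simp only [one_div_mul_eq_div] at i1 i2 h
  exact ⟨i1, i2, h (b x)⟩

/-- On each sphere `g` is an affine function of `b` with constant coefficients, and countably many
spheres cover almost everything; `c` and `d` need not be measurable. -/
theorem aemeasurable_of_radial (hn : n ≠ 0) {g : Qpn p n → ℝ} (hb : AEMeasurable b (haar p n))
    (c d : ℝ → ℝ) (h : ∀ x, g x = b x * c ‖x‖ - d ‖x‖) : AEMeasurable g (haar p n) := by
  rw [← Measure.restrict_eq_self_of_ae_mem (s := {0}ᶜ) (ae_ne_zero hn), ← iUnion_sphereS,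
    aemeasurable_iUnion_iff]
  intro l
  refine ((hb.restrict.mul_const (c ((p : ℝ) ^ l))).sub_const (d ((p : ℝ) ^ l))).congr ?_
  refine (ae_restrict_iff' (measurableSet_sphereS l)).2 (Eventually.of_forall fun x hx => ?_)
  have hx' : ‖x‖ = (p : ℝ) ^ l := hx
  simp only [h, hx']

theorem aemeasurable_hardyComm (hn : n ≠ 0) (hb : AEMeasurable b (haar p n)) :
    AEMeasurable (hardyComm α b f) (haar p n) :=
  aemeasurable_of_radial hn hb
    (fun r => 1 / r ^ ((n : ℝ) - α) * ∫ t in {t : Qpn p n | ‖t‖ ≤ r}, f t ∂(haar p n))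
    (fun r => 1 / r ^ ((n : ℝ) - α) * ∫ t in {t : Qpn p n | ‖t‖ ≤ r}, b t * f t ∂(haar p n))
    fun _ => rfl

theorem aemeasurable_hardyAdjComm (hn : n ≠ 0) (hb : AEMeasurable b (haar p n)) :
    AEMeasurable (hardyAdjComm α b f) (haar p n) :=
  aemeasurable_of_radial hn hb
    (fun r => ∫ t in {t : Qpn p n | r < ‖t‖}, f t / ‖t‖ ^ ((n : ℝ) - α) ∂(haar p n))
    (fun r => ∫ t in {t : Qpn p n | r < ‖t‖}, b t * f t / ‖t‖ ^ ((n : ℝ) - α) ∂(haar p n))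
    fun _ => rfl

end Pointwise

/-! ### Norm estimates on spheres -/

theorem lpNorm_zero {u : Qpn p n → ℝ} (hu : ∀ᵐ x ∂haar p n, 0 < u x) :
    lpNorm u (fun _ => (0 : ℝ)) = 0 := by
  refine le_antisymm (ENNReal.le_of_forall_pos_le_add fun ε hε _ => ?_) zero_le
  rw [zero_add, ← ENNReal.ofReal_coe_nnreal]
  refine lpNorm_le_of_modular_le hε ?_
  rw [modular, lintegral_congr_ae (g := fun _ => 0)]
  · simp
  · filter_upwards [hu] with x hx
    simp [Real.zero_rpow hx.ne']

theorem lpNorm_nonneg_mul_le {u f : Qpn p n → ℝ} (hu : ∀ᵐ x ∂haar p n, 0 < u x) {c : ℝ}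
    (hc : 0 ≤ c) : lpNorm u (fun x => c * f x) ≤ ENNReal.ofReal c * lpNorm u f := by
  rcases hc.eq_or_lt with rfl | h
  · simp [lpNorm_zero hu]
  · exact lpNorm_const_mul_le h

theorem BallBounds.lpNorm_sphereS_le {α : ℝ} {u v b g : Qpn p n → ℝ} {D : ℤ → ℝ} {C : ℝ}
    (hB : BallBounds α u v b D C) (hvm : Measurable v) (hv : ∀ᵐ x ∂haar p n, 1 ≤ v x)
    {l : ℤ} {T : ℝ≥0∞} (hT : T ≠ ∞)
    (hg : ∀ x ∈ sphereS p n l, |g x| ≤ (1 + |b x - mean b l|) * T.toReal) :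
    lpNorm v ((sphereS p n l).indicator g)
      ≤ ENNReal.ofReal (2 * C) * ((p : ℝ≥0∞) ^ D l * T) := by
  have hv0 : ∀ᵐ x ∂haar p n, 0 < v x := hv.mono fun x hx => zero_lt_one.trans_le hx
  set χ := (ballB (0 : Qpn p n) l).indicator fun _ => (1 : ℝ)
  set o := (ballB (0 : Qpn p n) l).indicator fun x => b x - mean b l
  have habs : lpNorm v (fun x => |o x|) ≤ lpNorm v o :=
    lpNorm_mono (hv0.mono fun x hx => hx.le) (Eventually.of_forall fun x => (abs_abs _).le)
  have hχm : Measurable χ := measurable_const.indicator (measurableSet_ballB 0 l)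
  calc lpNorm v ((sphereS p n l).indicator g)
      ≤ lpNorm v (fun x => T.toReal * (χ x + |o x|)) := by
        refine lpNorm_mono (hv0.mono fun x hx => hx.le) (Eventually.of_forall fun x => ?_)
        by_cases hx : x ∈ sphereS p n l
        · have hxB := sphereS_subset_ballB le_rfl hx
          simp only [χ, o, Set.indicator_of_mem hx, Set.indicator_of_mem hxB]
          rw [abs_of_nonneg (mul_nonneg ENNReal.toReal_nonneg (by positivity)), mul_comm]
          exact hg x hx
        · rw [Set.indicator_of_notMem hx, abs_zero]; exact abs_nonneg _
    _ ≤ ENNReal.ofReal T.toReal * (lpNorm v χ + lpNorm v o) := by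
        refine (lpNorm_nonneg_mul_le hv0 ENNReal.toReal_nonneg).trans (mul_le_mul_right ?_ _)
        exact (lpNorm_add_le hvm hv hχm.aemeasurable).trans (add_le_add_right habs _)
    _ ≤ T * (ENNReal.ofReal C * (p : ℝ≥0∞) ^ D l + ENNReal.ofReal C * (p : ℝ≥0∞) ^ D l) := by
        rw [ENNReal.ofReal_toReal hT]
        exact mul_le_mul_right (add_le_add (hB.chi_v l) (hB.osc_v l)) _
    _ = _ := by
        rw [ENNReal.ofReal_mul zero_le_two, ENNReal.ofReal_ofNat]; ring

/-! ### Herz norms -/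

theorem herzNorm_eq (β m : ℝ) (u f : Qpn p n → ℝ) : herzNorm β m u f =
    (∑' l : ℤ, ((p : ℝ≥0∞) ^ ((l : ℝ) * β) * lpNorm u ((sphereS p n l).indicator f)) ^ m) ^
      (1 / m) := by
  rw [herzNorm]
  congr 1
  refine tsum_congr fun l => ?_
  rw [← ofReal_p_rpow, ← lpNorm_const_mul (Real.rpow_pos_of_pos (p_pos p) _)]
  congr 2
  ext x
  by_cases hx : x ∈ sphereS p n l <;> simp [hx]

/-- Convolution is bounded on `ℓ^{m₁}`, followed by `ℓ^{m₁} ⊆ ℓ^{m₂}`. -/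
theorem herzNorm_le_of_geometric {ε β m₁ m₂ : ℝ} (hε : 0 < ε) (hm₁ : 0 < m₁) (hm : m₁ ≤ m₂)
    {C : ℝ≥0∞} (hC : C ≠ ∞) (u v : Qpn p n → ℝ) :
    ∃ C' : ℝ≥0∞, C' ≠ ∞ ∧ ∀ f g : Qpn p n → ℝ,
      (∀ l : ℤ, (p : ℝ≥0∞) ^ ((l : ℝ) * β) * lpNorm v ((sphereS p n l).indicator g) ≤
        C * ∑' k : ℤ, (p : ℝ≥0∞) ^ (-(ε * |(l : ℝ) - k|)) *
          ((p : ℝ≥0∞) ^ ((k : ℝ) * β) * lpNorm u ((sphereS p n k).indicator f))) →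
      herzNorm β m₂ v g ≤ C' * herzNorm β m₁ u f := by
  obtain ⟨K, hK, hconv⟩ := tsum_geometric_conv_rpow_le (p := p) hε hm₁
  refine ⟨C * K ^ (1 / m₁), ENNReal.mul_ne_top hC
    (ENNReal.rpow_ne_top_of_nonneg (by positivity) hK), fun f g h => ?_⟩
  rw [herzNorm_eq, herzNorm_eq]
  set x : ℤ → ℝ≥0∞ := fun l =>
    (p : ℝ≥0∞) ^ ((l : ℝ) * β) * lpNorm v ((sphereS p n l).indicator g)
  set a : ℤ → ℝ≥0∞ := fun k =>
    (p : ℝ≥0∞) ^ ((k : ℝ) * β) * lpNorm u ((sphereS p n k).indicator f)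
  have hm₂ := hm₁.trans_le hm
  calc (∑' l, x l ^ m₂) ^ (1 / m₂)
      ≤ ((∑' l, x l ^ m₁) ^ (m₂ / m₁)) ^ (1 / m₂) :=
        ENNReal.rpow_le_rpow (tsum_rpow_le_tsum_rpow x hm₁ hm) (by positivity)
    _ = (∑' l, x l ^ m₁) ^ (1 / m₁) := by
        rw [← ENNReal.rpow_mul]; congr 1; field_simp
    _ ≤ (C ^ m₁ * (K * ∑' k, a k ^ m₁)) ^ (1 / m₁) := by
        refine ENNReal.rpow_le_rpow ?_ (by positivity)
        refine le_trans ?_ (mul_le_mul_right (hconv a) _)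
        rw [← ENNReal.tsum_mul_left]
        refine ENNReal.tsum_le_tsum fun l => ?_
        rw [← ENNReal.mul_rpow_of_nonneg _ _ hm₁.le]
        exact ENNReal.rpow_le_rpow (h l) hm₁.le
    _ = C * K ^ (1 / m₁) * (∑' k, a k ^ m₁) ^ (1 / m₁) := by
        rw [ENNReal.mul_rpow_of_nonneg _ _ (by positivity),
          ENNReal.mul_rpow_of_nonneg _ _ (by positivity), ← ENNReal.rpow_mul,
          mul_one_div_cancel hm₁.ne', ENNReal.rpow_one, mul_assoc]

theorem le_herzNorm {β m : ℝ} (hm : 0 < m) (u f : Qpn p n → ℝ) (l : ℤ) :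
    (p : ℝ≥0∞) ^ ((l : ℝ) * β) * lpNorm u ((sphereS p n l).indicator f) ≤ herzNorm β m u f := by
  rw [herzNorm_eq]
  exact le_tsum_rpow (fun l : ℤ =>
    (p : ℝ≥0∞) ^ ((l : ℝ) * β) * lpNorm u ((sphereS p n l).indicator f)) hm l

/-! ### Local integrability -/

theorem modular_sphereS_le {u f : Qpn p n → ℝ} (hu : ∀ᵐ x ∂haar p n, 0 < u x) (l : ℤ) :
    modular u ((sphereS p n l).indicator f)
      ≤ ∫⁻ x in sphereS p n l, ENNReal.ofReal (|f x| ^ u x) ∂haar p n := by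
  rw [modular, ← lintegral_indicator (measurableSet_sphereS l)]
  refine lintegral_mono_ae ?_
  filter_upwards [hu] with x hx
  by_cases hxl : x ∈ sphereS p n l <;> simp [hxl, Real.zero_rpow hx.ne']

/-- Near the origin the norms on spheres of a function in `L^{u(·)}_loc` lie in `ℓ^w`
as soon as `u ≤ w` there. -/
theorem tsum_lpNorm_sphereS_rpow_lt_top (hn : n ≠ 0) {u f : Qpn p n → ℝ} {w : ℝ} (hw : 0 < w)
    (hu : ∀ᵐ x ∂haar p n, 0 < u x) (N : ℤ)
    (huw : ∀ᵐ x ∂haar p n, x ∈ ballB (0 : Qpn p n) N → u x ≤ w) (hf : MemLpVarLoc u f) :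
    ∃ ρ : ℤ → ℝ≥0∞, ∑' k, ρ k ≠ ∞ ∧ ∀ k ≤ N, lpNorm u ((sphereS p n k).indicator f) ^ w ≤ ρ k := by
  have hfin := (hf _ (isCompact_ballB 0 N)).2
  obtain ⟨s, hs⟩ : ∃ s : NNReal, lpNorm u ((ballB (0 : Qpn p n) N).indicator f) < s :=
    ENNReal.lt_iff_exists_nnreal_btwn.1 hfin |>.imp fun s hs => hs.1
  have hs0 : 0 < (s : ℝ) := by
    have : (0 : ℝ≥0∞) < s := bot_le.trans_lt hs
    exact_mod_cast this
  rw [← ENNReal.ofReal_coe_nnreal] at hs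
  have hmod := modular_div_le_one (hu.mono fun x hx => hx.le) hs
  set h : Qpn p n → ℝ := fun x => (ballB (0 : Qpn p n) N).indicator f x / s with hh
  have hsum : ∑' k, ∫⁻ x in sphereS p n k, ENNReal.ofReal (|h x| ^ u x) ∂haar p n ≤ 1 := by
    rw [← lintegral_eq_tsum_sphereS hn]; exact hmod
  -- After division by `s` the modulars over the spheres have sum at most `1`, and each one
  -- dominates the `w`-th power of its norm.
  refine ⟨fun k => ENNReal.ofReal s ^ w *
    ∫⁻ x in sphereS p n k, ENNReal.ofReal (|h x| ^ u x) ∂haar p n, ?_, fun k hk => ?_⟩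
  · rw [ENNReal.tsum_mul_left]
    exact ENNReal.mul_ne_top (ENNReal.rpow_ne_top_of_nonneg hw.le ENNReal.ofReal_ne_top)
      (ne_top_of_le_ne_top ENNReal.one_ne_top hsum)
  have hmk := modular_sphereS_le (f := h) hu k
  have h1 : lpNorm u ((sphereS p n k).indicator h) ^ w ≤ _ :=
    (lpNorm_rpow_le_modular hw hu (huw.mono fun x hx hfx => hx (sphereS_subset_ballB hk
      (Set.mem_of_indicator_ne_zero hfx)))
      (hmk.trans ((ENNReal.le_tsum k).trans hsum))).trans hmk
  have e : (sphereS p n k).indicator f = fun x => (s : ℝ) * (sphereS p n k).indicator h x := by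
    ext x
    by_cases hx : x ∈ sphereS p n k
    · rw [Set.indicator_of_mem hx, Set.indicator_of_mem hx, hh]
      simp only [Set.indicator_of_mem (sphereS_subset_ballB hk hx)]
      field_simp
    · simp [hx]
  rw [e, lpNorm_const_mul hs0, ENNReal.mul_rpow_of_nonneg _ _ hw.le]
  exact mul_le_mul_right h1 _

/-- Near `0` the sphere norms of `f` lie in `ℓ^w` by local integrability; away from `0` the Herz
bound against the weaker slope `β - η` supplies decay `p^(-η|k|)`. So the weighted sequence of `f`,
and by convolution the majorant of `g`, is in `ℓ^w`. Since `w ≤ v ≤ M` near `0`, the modular of `g`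
there is at most the sum of `w`-th and `M`-th powers. -/
theorem memLpVarLoc_of_geometric (hn : n ≠ 0) {u v f g : Qpn p n → ℝ} {ε β η w M : ℝ} {N : ℤ}
    (hε : 0 < ε) (hη : 0 < η) (hw : 0 < w) (hN : N < 0)
    (hu : ∀ᵐ x ∂haar p n, 0 < u x) (hv : ∀ᵐ x ∂haar p n, 1 ≤ v x ∧ v x ≤ M)
    (huvw : ∀ᵐ x ∂haar p n, x ∈ ballB (0 : Qpn p n) N → u x ≤ w ∧ w ≤ v x)
    (hf : MemLpVarLoc u f) {A C : ℝ≥0∞} (hA : A ≠ ∞) (hC : C ≠ ∞)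
    (hfA : ∀ k : ℤ, (p : ℝ≥0∞) ^ ((k : ℝ) * β) * lpNorm u ((sphereS p n k).indicator f) ≤ A)
    (hgm : AEMeasurable g (haar p n))
    (hgfin : ∀ l, lpNorm v ((sphereS p n l).indicator g) < ∞)
    (hg : ∀ l : ℤ, (p : ℝ≥0∞) ^ ((l : ℝ) * signSeq 0 (β - η) l) *
        lpNorm v ((sphereS p n l).indicator g) ≤
        C * ∑' k : ℤ, (p : ℝ≥0∞) ^ (-(ε * |(l : ℝ) - k|)) *
          ((p : ℝ≥0∞) ^ ((k : ℝ) * signSeq 0 (β - η) k) *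
            lpNorm u ((sphereS p n k).indicator f))) :
    MemLpVarLoc v g := by
  have hv0 : ∀ᵐ x ∂haar p n, 0 < v x := hv.mono fun x hx => zero_lt_one.trans_le hx.1
  set a : ℤ → ℝ≥0∞ := fun k => (p : ℝ≥0∞) ^ ((k : ℝ) * signSeq 0 (β - η) k) *
    lpNorm u ((sphereS p n k).indicator f) with ha
  obtain ⟨ρ, hρ, hρle⟩ := tsum_lpNorm_sphereS_rpow_lt_top hn hw hu N
    (huvw.mono fun x hx h => (hx h).1) hf
  have hale : ∀ k, a k ^ w ≤ ρ k + (A * (p : ℝ≥0∞) ^ (-(N : ℝ) * (|β| + η))) ^ w *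
      (p : ℝ≥0∞) ^ (-(η * w * |(k : ℝ)|)) := by
    intro k
    rcases le_or_gt k N with hk | hk
    · refine le_add_right ?_
      have : a k = lpNorm u ((sphereS p n k).indicator f) := by
        simp [ha, signSeq, show k < 0 by omega]
      rw [this]
      exact hρle k hk
    -- The constant `p^(-N(|β| + η))` covers the finitely many negative indices above `N`, where the
    -- weight is still `1`.
    · refine le_add_left ?_
      have hN' : (N : ℝ) < 0 := by exact_mod_cast hN
      have hkN : (N : ℝ) < k := by exact_mod_cast hk
      have h1 : a k ≤ A * (p : ℝ≥0∞) ^ (-(N : ℝ) * (|β| + η)) *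
          (p : ℝ≥0∞) ^ (-(η * |(k : ℝ)|)) := by
        calc a k = (p : ℝ≥0∞) ^ ((k : ℝ) * signSeq 0 (β - η) k - k * β) *
              ((p : ℝ≥0∞) ^ ((k : ℝ) * β) * lpNorm u ((sphereS p n k).indicator f)) := by
              rw [← mul_assoc, ← p_rpow_add, sub_add_cancel]
          _ ≤ (p : ℝ≥0∞) ^ (-(N : ℝ) * (|β| + η) + -(η * |(k : ℝ)|)) * A := by
              refine mul_le_mul' (p_rpow_mono ?_) (hfA k)
              have hβ := abs_nonneg β
              unfold signSeq
              split_ifs with h0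
              · have h0' : (k : ℝ) < 0 := by exact_mod_cast h0
                rw [abs_of_neg h0']
                nlinarith [neg_abs_le β, le_abs_self β]
              · have h0' : (0 : ℝ) ≤ k := by exact_mod_cast not_lt.1 h0
                rw [abs_of_nonneg h0']
                nlinarith
          _ = _ := by rw [p_rpow_add]; ring
      refine (ENNReal.rpow_le_rpow h1 hw.le).trans (le_of_eq ?_)
      rw [ENNReal.mul_rpow_of_nonneg _ _ hw.le, ← ENNReal.rpow_mul]
      congr 2; ring
  have hasum : ∑' k, a k ^ w ≠ ∞ := by
    refine ne_top_of_le_ne_top ?_ (ENNReal.tsum_le_tsum hale)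
    rw [ENNReal.tsum_add, ENNReal.tsum_mul_left]
    exact ENNReal.add_ne_top.2 ⟨hρ, ENNReal.mul_ne_top (ENNReal.rpow_ne_top_of_nonneg hw.le
      (ENNReal.mul_ne_top hA (p_rpow_ne_top _))) (tsum_geometric_int_ne_top (by positivity))⟩
  obtain ⟨K, hK, hconv⟩ := tsum_geometric_conv_rpow_le (p := p) hε hw
  set y : ℤ → ℝ≥0∞ := fun l => C * ∑' k : ℤ, (p : ℝ≥0∞) ^ (-(ε * |(l : ℝ) - k|)) * a k with hy
  have hyw : ∑' l, y l ^ w ≠ ∞ := by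
    simp_rw [hy, ENNReal.mul_rpow_of_nonneg _ _ hw.le, ENNReal.tsum_mul_left]
    exact ENNReal.mul_ne_top (ENNReal.rpow_ne_top_of_nonneg hw.le hC)
      (ne_top_of_le_ne_top (ENNReal.mul_ne_top hK hasum) (hconv a))
  have hwM : w ≤ M := by
    by_contra hcon
    have hae : ∀ᵐ x ∂haar p n, x ∉ ballB (0 : Qpn p n) N := by
      filter_upwards [hv, huvw] with x hx h hxB
      exact hcon ((h hxB).2.trans hx.2)
    rw [ae_iff] at hae
    simp only [not_not] at hae
    exact haar_ballB_ne_zero N hae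
  have hM0 : 0 < M := hw.trans_le hwM
  have hyM : ∑' l, y l ^ M ≠ ∞ := ne_top_of_le_ne_top
    (ENNReal.rpow_ne_top_of_nonneg (by positivity) hyw) (tsum_rpow_le_tsum_rpow y hw hwM)
  intro S hS
  obtain ⟨R, hR⟩ := hS.isBounded.exists_norm_le
  obtain ⟨L, hL⟩ := pow_unbounded_of_one_lt R (one_lt_p p)
  refine ⟨hgm.indicator hS.measurableSet,
    lpNorm_lt_top_of_modular_lt_top (hv.mono fun x hx => hx.1) ?_⟩
  set z : ℤ → ℝ≥0∞ := fun l => lpNorm v ((sphereS p n l).indicator g) with hz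
  -- A compact set meets only spheres with index at most `L`; those above `N` are finitely many, and
  -- each contributes a finite modular.
  set F : Finset ℤ := Finset.Icc N L with hF
  set q : ℤ → ℝ≥0∞ := fun l => if l ∈ F then z l ^ (1 : ℝ) + z l ^ M else 0 with hq
  have hterm : ∀ l : ℤ, ∫⁻ x in sphereS p n l, ENNReal.ofReal (|S.indicator g x| ^ v x) ∂haar p n
      ≤ y l ^ w + y l ^ M + q l := by
    intro l
    have hgl : ∫⁻ x in sphereS p n l, ENNReal.ofReal (|S.indicator g x| ^ v x) ∂haar p n
        ≤ modular v ((sphereS p n l).indicator g) := by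
      rw [modular, ← lintegral_indicator (measurableSet_sphereS l)]
      refine lintegral_mono_ae ?_
      filter_upwards [hv0] with x hx
      by_cases hxl : x ∈ sphereS p n l
      · simp only [Set.indicator_of_mem hxl]
        by_cases hxS : x ∈ S
        · rw [Set.indicator_of_mem hxS]
        · simp [hxS, Real.zero_rpow hx.ne']
      · simp [hxl]
    rcases le_or_gt l N with hlN | hlN
    · refine le_add_right (hgl.trans ?_)
      have hzy : z l ≤ y l := by
        have hl : signSeq 0 (β - η) l = 0 := if_pos (by omega)
        simpa only [hl, mul_zero, ENNReal.rpow_zero, one_mul] using hg l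
      refine (modular_le_rpow_add_rpow (lo := w) (hi := M) ?_ hv0 (hgfin l)).trans
        (add_le_add (ENNReal.rpow_le_rpow hzy hw.le) (ENNReal.rpow_le_rpow hzy hM0.le))
      filter_upwards [hv, huvw] with x hx h hgx
      exact ⟨(h (sphereS_subset_ballB hlN (Set.mem_of_indicator_ne_zero hgx))).2, hx.2⟩
    · refine le_add_left ?_
      rcases le_or_gt l L with hlL | hlL
      · have : q l = z l ^ (1 : ℝ) + z l ^ M := by
          simp [hq, hF, hlN.le, hlL]
        rw [this]
        exact hgl.trans (modular_le_rpow_add_rpow (hv.mono fun x hx _ => hx) hv0 (hgfin l))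
      · refine le_trans (le_of_eq ?_) zero_le
        rw [setLIntegral_congr_fun_ae (measurableSet_sphereS l) (g := fun _ => 0)]
        · simp
        · filter_upwards [hv0] with x hx hxl
          have hxS : x ∉ S := by
            intro hxS
            have h1 := hR x hxS
            rw [show ‖x‖ = (p : ℝ) ^ l from hxl] at h1
            have h2 : (p : ℝ) ^ (L : ℤ) < (p : ℝ) ^ l := zpow_lt_zpow_right₀ (one_lt_p p) hlL
            rw [zpow_natCast] at h2
            linarith
          simp [hxS, Real.zero_rpow hx.ne']
  rw [modular, lintegral_eq_tsum_sphereS hn]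
  refine (ENNReal.tsum_le_tsum hterm).trans_lt ?_
  rw [ENNReal.tsum_add, ENNReal.tsum_add]
  refine (ENNReal.add_ne_top.2 ⟨ENNReal.add_ne_top.2 ⟨hyw, hyM⟩, ?_⟩).lt_top
  rw [tsum_eq_sum (s := F) fun l hl => by simp [hq, hl]]
  refine ENNReal.sum_ne_top.2 fun l hl => ?_
  simp only [hq, hl, if_true]
  exact ENNReal.add_ne_top.2 ⟨ENNReal.rpow_ne_top_of_nonneg zero_le_one (hgfin l).ne,
    ENNReal.rpow_ne_top_of_nonneg hM0.le (hgfin l).ne⟩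

/-! ### Derivation of the ball bounds -/

theorem MemCMO.lpNorm_sub_mean_le {u b : Qpn p n → ℝ} (hb : MemCMO u b) {k : ℤ}
    (hk : lpNorm u ((ballB (0 : Qpn p n) k).indicator fun _ => (1 : ℝ)) ≠ ∞) :
    lpNorm u ((ballB (0 : Qpn p n) k).indicator fun x => b x - mean b k)
      ≤ cmoNorm u b * lpNorm u ((ballB (0 : Qpn p n) k).indicator fun _ => (1 : ℝ)) := by
  have h := le_iSup (fun γ : ℤ => (lpNorm u ((ballB (0 : Qpn p n) γ).indicator
    fun _ => (1 : ℝ)))⁻¹ * lpNorm u ((ballB (0 : Qpn p n) γ).indicator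
      fun x => b x - mean b γ)) k
  change _ ≤ cmoNorm u b at h
  set c := lpNorm u ((ballB (0 : Qpn p n) k).indicator fun _ => (1 : ℝ))
  set o := lpNorm u ((ballB (0 : Qpn p n) k).indicator fun x => b x - mean b k)
  rcases eq_or_ne c 0 with hc | hc
  -- If the norm of `χ_{B_k}` were `0`, its inverse would be `∞`, and finiteness of `cmoNorm` would
  -- force the oscillation to vanish.
  · rw [hc, ENNReal.inv_zero] at h
    rcases eq_or_ne o 0 with ho | ho
    · rw [ho]; exact zero_le
    · rw [ENNReal.top_mul ho] at h
      exact absurd (h.trans_lt hb.2) (lt_irrefl _)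
  · calc o = c⁻¹ * o * c := by
          rw [mul_comm, ← mul_assoc, ENNReal.mul_inv_cancel hc hk, one_mul]
      _ ≤ _ := mul_le_mul_left h _

theorem signSeq_const_div (s V₀ V₁ : ℝ) (l : ℤ) :
    signSeq (s / V₀) (s / V₁) l = s / signSeq V₀ V₁ l := by
  unfold signSeq; split_ifs <;> rfl

theorem le_signSeq {r V₀ V₁ : ℝ} (h₀ : r ≤ V₀) (h₁ : r ≤ V₁) (l : ℤ) : r ≤ signSeq V₀ V₁ l := by
  unfold signSeq; split_ifs <;> assumption

theorem natCast_mul_le {c l x M K : ℝ} (n : ℕ) (hc : |c| ≤ M) (hx : |l| * |x| ≤ K) :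
    n * (c * (l * x)) ≤ n * (M * K) := by
  refine mul_le_mul_of_nonneg_left ((le_abs_self _).trans ?_) n.cast_nonneg
  rw [abs_mul, abs_mul]
  exact mul_le_mul hc hx (by positivity) ((abs_nonneg c).trans hc)

theorem one_le_conjExp {u : Qpn p n → ℝ} (hu : ∀ᵐ x ∂haar p n, 1 < u x) :
    ∀ᵐ x ∂haar p n, 1 ≤ conjExp u x :=
  hu.mono fun _ hx => (Real.HolderConjugate.conjExponent hx).symm.lt.le

/-- For each of `v`, `u'`, `v'` the quantity `l n - D_l w(x)` on `S_l` is a bounded multiple of `l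
(v(x) - V_l)`, hence bounded above. The exponent `v'` serves only to compare means of `b`. -/
theorem exists_ballBounds (hn : n ≠ 0) {α V₀ V₁ K M M' : ℝ} {u v b : Qpn p n → ℝ}
    (hvm : Measurable v) (hu : ∀ᵐ x ∂haar p n, 1 < u x) (hv : ∀ᵐ x ∂haar p n, 1 < v x)
    (huv : ∀ x, 1 / v x = 1 / u x - α / n)
    (hM : ∀ᵐ x ∂haar p n, conjExp u x ≤ M) (hM' : ∀ᵐ x ∂haar p n, conjExp v x ≤ M')
    (hV₀ : 1 ≤ V₀) (hV₁ : 1 ≤ V₁) (hα : 0 < α)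
    (hd₀ : 0 < n - α - n / V₀) (hd₁ : 0 < n - α - n / V₁)
    (hK : ∀ᵐ x ∂haar p n, ∀ l : ℤ, x ∈ sphereS p n l → |(l : ℝ)| * |v x - signSeq V₀ V₁ l| ≤ K)
    (hb₁ : MemCMO (conjExp u) b) (hb₂ : MemCMO v b) :
    ∃ C : ℝ, BallBounds α u v b (fun l => l * signSeq (n / V₀) (n / V₁) l) C := by
  have hn0 : (0 : ℝ) < n := by positivity
  have hV : ∀ l, 1 ≤ signSeq V₀ V₁ l := le_signSeq hV₀ hV₁
  obtain ⟨Cv, hCv, hchiv⟩ := lpNorm_indicator_ballB_le hn (w := v)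
    (D := fun l => l * signSeq (n / V₀) (n / V₁) l) (δ := min (n / V₀) (n / V₁)) (K := n * (1 * K))
    (by positivity) (hv.mono fun x hx => hx.le)
    (fun j k hjk => signSeq_growth (min_le_left _ _) (min_le_right _ _) hjk) (by
      filter_upwards [hK] with x hx l hl
      have hVl := hV l
      have e : (l : ℝ) * n - l * signSeq (n / V₀) (n / V₁) l * v x =
          n * ((-(1 / signSeq V₀ V₁ l)) * (l * (v x - signSeq V₀ V₁ l))) := by
        rw [signSeq_const_div]; field_simp; ring
      rw [e]
      refine natCast_mul_le n ?_ (hx l hl)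
      rw [abs_neg, abs_of_nonneg (by positivity), one_div]
      exact inv_le_one_of_one_le₀ hVl)
  obtain ⟨Cu, hCu, hchiu⟩ := lpNorm_indicator_ballB_le hn (w := conjExp u)
    (D := fun l => l * signSeq (n - α - n / V₀) (n - α - n / V₁) l)
    (δ := min (n - α - n / V₀) (n - α - n / V₁)) (K := n * (M * K))
    (lt_min hd₀ hd₁) (one_le_conjExp hu)
    (fun j k hjk => signSeq_growth (min_le_left _ _) (min_le_right _ _) hjk) (by
      filter_upwards [hK, hu, hv, hM] with x hx hux hvx hMx l hl
      have hVl := hV l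
      have hconj : (u x).HolderConjugate (conjExp u x) := Real.HolderConjugate.conjExponent hux
      have hpos := hconj.symm.pos
      -- This rests on `1/u' = 1 - 1/v - α/n`, the conjugate form of the relation between `u` and
      -- `v`.
      have e : (l : ℝ) * n - l * signSeq (n - α - n / V₀) (n - α - n / V₁) l * conjExp u x =
          n * (conjExp u x / (v x * signSeq V₀ V₁ l) * (l * (v x - signSeq V₀ V₁ l))) := by
        rw [signSeq_const_sub, signSeq_const_div]
        have h1 : (conjExp u x)⁻¹ = 1 - (1 / v x + α / n) := by
          rw [huv x, ← hconj.one_sub_inv]; ring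
        have h2 : (1 : ℝ) = conjExp u x * (1 - (1 / v x + α / n)) := by
          rw [← h1, mul_inv_cancel₀ hpos.ne']
        have hvx0 : v x ≠ 0 := by positivity
        have hV0 : signSeq V₀ V₁ l ≠ 0 := by positivity
        calc _ = l * n * 1 - l * (n - α - n / signSeq V₀ V₁ l) * conjExp u x := by ring
          _ = l * n * (conjExp u x * (1 - (1 / v x + α / n)))
              - l * (n - α - n / signSeq V₀ V₁ l) * conjExp u x := by rw [← h2]
          _ = _ := by field_simp; ring
      rw [e]
      refine natCast_mul_le n ?_ (hx l hl)
      rw [abs_of_nonneg (by positivity)]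
      exact (div_le_self hpos.le (one_le_mul_of_one_le_of_one_le hvx.le hVl)).trans hMx)
  obtain ⟨Cw, hCw, hchiw⟩ := lpNorm_indicator_ballB_le hn (w := conjExp v)
    (D := fun l => l * signSeq (n - n / V₀) (n - n / V₁) l) (δ := α) (K := n * (M' * K))
    hα (one_le_conjExp hv)
    (fun j k hjk => signSeq_growth (by linarith) (by linarith) hjk) (by
      filter_upwards [hK, hv, hM'] with x hx hvx hMx l hl
      have hVl := hV l
      have hv1 : 0 < v x - 1 := by linarith
      have e : (l : ℝ) * n - l * signSeq (n - n / V₀) (n - n / V₁) l * conjExp v x =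
          n * (1 / (signSeq V₀ V₁ l * (v x - 1)) * (l * (v x - signSeq V₀ V₁ l))) := by
        rw [signSeq_const_sub, signSeq_const_div, conjExp, Real.conjExponent]
        field_simp; ring
      rw [e]
      refine natCast_mul_le n ?_ (hx l hl)
      rw [abs_of_nonneg (by positivity)]
      -- `1/(v - 1) ≤ v/(v - 1) = v'`, so the bound on `v'` keeps `v - 1` away from zero.
      refine le_trans ?_ hMx
      rw [conjExp, Real.conjExponent]
      gcongr
      exact le_mul_of_one_le_left hv1.le hVl)
  have hfin : ∀ {c : ℝ≥0∞} (x : ℝ), c ≠ ∞ → c * (p : ℝ≥0∞) ^ x ≠ ∞ := fun x hc =>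
    ENNReal.mul_ne_top hc (p_rpow_ne_top x)
  have hoscv : ∀ k : ℤ, lpNorm v ((ballB (0 : Qpn p n) k).indicator fun x => b x - mean b k) ≤
      cmoNorm v b * Cv * (p : ℝ≥0∞) ^ (k * signSeq (n / V₀) (n / V₁) k) := fun k => by
    rw [mul_assoc]
    exact (hb₂.lpNorm_sub_mean_le (ne_top_of_le_ne_top (hfin _ hCv) (hchiv k))).trans
      (mul_le_mul_right (hchiv k) _)
  have hoscu : ∀ k : ℤ, lpNorm (conjExp u) ((ballB (0 : Qpn p n) k).indicator
      fun x => b x - mean b k) ≤ cmoNorm (conjExp u) b * Cu *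
        (p : ℝ≥0∞) ^ (k * signSeq (n - α - n / V₀) (n - α - n / V₁) k) := fun k => by
    rw [mul_assoc]
    exact (hb₁.lpNorm_sub_mean_le (ne_top_of_le_ne_top (hfin _ hCu) (hchiu k))).trans
      (mul_le_mul_right (hchiu k) _)
  have hNv : cmoNorm v b * Cv ≠ ∞ := ENNReal.mul_ne_top hb₂.2.ne hCv
  have hNu : cmoNorm (conjExp u) b * Cu ≠ ∞ := ENNReal.mul_ne_top hb₁.2.ne hCu
  have hbm := hb₂.1.aemeasurable
  obtain ⟨A, hA, hmean⟩ := mean_sub_le hvm hv hbm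
    (D := fun l => l * signSeq (n / V₀) (n / V₁) l)
    (C := cmoNorm v b * Cv + Cw) (ENNReal.add_ne_top.2 ⟨hNv, hCw⟩)
    (fun k => (hoscv k).trans (mul_le_mul_left le_self_add _)) (fun k => by
      rw [← mul_sub, ← signSeq_const_sub]
      exact (hchiw k).trans (mul_le_mul_left le_add_self _))
  set S : ℝ≥0∞ := cmoNorm v b * Cv + cmoNorm (conjExp u) b * Cu + Cv + Cu + ENNReal.ofReal A
    with hS
  have hSt : S ≠ ∞ := by
    simp only [hS, ne_eq, ENNReal.add_eq_top, not_or]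
    exact ⟨⟨⟨⟨hNv, hNu⟩, hCv⟩, hCu⟩, ENNReal.ofReal_ne_top⟩
  have hDu : ∀ k : ℤ, (k : ℝ) * signSeq (n - α - n / V₀) (n - α - n / V₁) k =
      (k : ℝ) * (n - α) - k * signSeq (n / V₀) (n / V₁) k := fun k => by
    rw [signSeq_const_sub, mul_sub]
  refine ⟨S.toReal, ENNReal.toReal_nonneg, hbm, fun k l => (hmean k l).trans ?_, fun k => ?_,
    fun k => ?_, fun k => ?_, fun k => ?_⟩
  · refine mul_le_mul_of_nonneg_right ?_ (abs_nonneg _)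
    rw [← ENNReal.ofReal_le_iff_le_toReal hSt]
    exact le_add_self
  · rw [ENNReal.ofReal_toReal hSt]
    refine (hchiv k).trans (mul_le_mul_left ?_ _)
    rw [hS]
    exact le_add_right (le_add_right le_add_self)
  · rw [ENNReal.ofReal_toReal hSt]
    refine (hoscv k).trans (mul_le_mul_left ?_ _)
    rw [hS, add_assoc, add_assoc, add_assoc]
    exact le_self_add
  · rw [ENNReal.ofReal_toReal hSt, ← hDu]
    refine (hchiu k).trans (mul_le_mul_left ?_ _)
    rw [hS]
    exact le_add_right le_add_self
  · rw [ENNReal.ofReal_toReal hSt, ← hDu]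
    refine (hoscu k).trans (mul_le_mul_left ?_ _)
    rw [hS]
    exact le_add_right (le_add_right (le_add_right le_add_self))

/-! ### Boundedness of dominated operators -/

/-- If near the origin `v` is close to a constant, then some number separates `u` from `v` there. -/
theorem exists_separating_exponent (hn : n ≠ 0) {α V₀ V₁ K : ℝ} {u v : Qpn p n → ℝ} (hα : 0 < α)
    (hu : ∀ x, 1 ≤ u x) (hv : ∀ x, 1 ≤ v x) (huv : ∀ x, 1 / v x = 1 / u x - α / n) (hV₀ : 1 ≤ V₀)
    (hK : ∀ᵐ x ∂haar p n, ∀ l : ℤ, x ∈ sphereS p n l →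
      |(l : ℝ)| * |v x - signSeq V₀ V₁ l| ≤ K) :
    ∃ (w : ℝ) (N : ℤ), 0 < w ∧ N < 0 ∧
      ∀ᵐ x ∂haar p n, x ∈ ballB (0 : Qpn p n) N → u x ≤ w ∧ w ≤ v x := by
  have hn0 : (0 : ℝ) < n := by positivity
  -- Once `|v - V₀| ≤ κ ≤ 1/2`, `1/(V₀ - κ)` exceeds `1/v` by at most `4κ`: the numerator is at most
  -- `2κ` and the denominator at least `1/2`. As `4κ ≤ α/n = 1/u - 1/v`, this gives `u ≤ V₀ - κ`.
  set κ : ℝ := min (1 / 2) (α / (4 * n)) with hκ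
  have hκ0 : 0 < κ := by positivity
  have hκ1 : κ ≤ 1 / 2 := min_le_left _ _
  have hκ2 : 4 * κ ≤ α / n := by
    have : κ ≤ α / (4 * n) := min_le_right _ _
    calc 4 * κ ≤ 4 * (α / (4 * n)) := by linarith
      _ = α / n := by field_simp
  obtain ⟨N, hN⟩ := exists_nat_gt (K / κ)
  refine ⟨V₀ - κ, -((N : ℤ) + 1), by linarith, by omega, ?_⟩
  filter_upwards [hK, ae_ne_zero hn] with x hx hx0 hxB
  obtain ⟨l, hl⟩ := exists_mem_sphereS hx0
  have hlN : l ≤ -((N : ℤ) + 1) := by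
    rw [mem_ballB_zero, show ‖x‖ = (p : ℝ) ^ l from hl, zpow_le_zpow_iff_right₀ (one_lt_p p)] at hxB
    exact hxB
  have h := hx l hl
  rw [show signSeq V₀ V₁ l = V₀ from if_pos (by omega)] at h
  have hlN' : (l : ℝ) ≤ -((N : ℝ) + 1) := by exact_mod_cast hlN
  have hN0 : (0 : ℝ) ≤ N := N.cast_nonneg
  rw [abs_of_neg (by linarith)] at h
  rw [div_lt_iff₀ hκ0] at hN
  have hclose : |v x - V₀| ≤ κ := by
    by_contra! hcon
    nlinarith
  obtain ⟨h1, h2⟩ := abs_le.1 hclose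
  refine ⟨?_, by linarith⟩
  have hw : 0 < V₀ - κ := by linarith
  have hux := hu x
  have hvx := hv x
  rw [← inv_le_inv₀ hw (by linarith), ← one_div, ← one_div]
  have h3 : 1 / (V₀ - κ) - 1 / v x ≤ 4 * κ := by
    rw [div_sub_div _ _ hw.ne' (by linarith), div_le_iff₀ (by positivity)]
    nlinarith [mul_nonneg (sub_nonneg.2 hvx) hκ0.le,
      mul_nonneg (mul_nonneg (sub_nonneg.2 hvx) hκ0.le) (by linarith : 0 ≤ V₀ - κ - 1 / 2)]
  linarith [huv x]

/-- Every operator dominated on spheres by the kernel integral is bounded on Herz spaces. -/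
theorem exists_herz_bound (hn : n ≠ 0) {α β m₁ m₂ d₀ d₁ C w M : ℝ} {N : ℤ}
    {u v b : Qpn p n → ℝ} (hm₁ : 0 < m₁) (hm : m₁ ≤ m₂) (hum : Measurable u) (hvm : Measurable v)
    (hu : ∀ᵐ x ∂haar p n, 1 < u x) (hv : ∀ᵐ x ∂haar p n, 1 ≤ v x ∧ v x ≤ M)
    (hB : BallBounds α u v b (fun l => l * signSeq d₀ d₁ l) C)
    (hd₀ : 0 < d₀) (hd₀' : 0 < n - α - d₀) (hd₀β : 0 < d₀ + β) (hd₁β : 0 < d₁ + β)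
    (hd₀β' : 0 < n - α - (d₀ + β)) (hd₁β' : 0 < n - α - (d₁ + β)) (hw : 0 < w) (hN : N < 0)
    (huvw : ∀ᵐ x ∂haar p n, x ∈ ballB (0 : Qpn p n) N → u x ≤ w ∧ w ≤ v x) :
    (∀ f, MemHerz β m₁ u f → ∀ l, kernelIntegral α b f l ≠ ∞) ∧
    ∃ C' : NNReal, ∀ f, MemHerz β m₁ u f → ∀ g, AEMeasurable g (haar p n) →
      (∀ l, ∀ x ∈ sphereS p n l,
        |g x| ≤ (1 + |b x - mean b l|) * (kernelIntegral α b f l).toReal) →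
      MemHerz β m₂ v g ∧ herzNorm β m₂ v g ≤ C' * herzNorm β m₁ u f := by
  have hconst : ∀ k : ℤ, signSeq β β k = β := fun k => ite_self _
  -- Lowering the slope at nonnegative indices to `β - η` leaves `d₁ + β - η = η > 0`, so the kernel
  -- estimate survives with room for decay.
  set η : ℝ := (d₁ + β) / 2 with hη
  have hη0 : 0 < η := half_pos hd₁β
  set δ : ℝ := min (min (d₀ + β) (d₁ + β)) (min (n - α - (d₀ + β)) (n - α - (d₁ + β))) with hδ
  have hδ0 : 0 < δ := lt_min (lt_min hd₀β hd₁β) (lt_min hd₀β' hd₁β')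
  obtain ⟨C₁, hC₁, hT₁⟩ := hB.weighted_kernelIntegral_le hn (β₀ := β) (β₁ := β) hδ0 hum hu
    ((min_le_left _ _).trans (min_le_left _ _)) ((min_le_left _ _).trans (min_le_right _ _))
    ((min_le_right _ _).trans (min_le_left _ _)) ((min_le_right _ _).trans (min_le_right _ _))
  set δ' : ℝ := min (min d₀ η) (min (n - α - d₀) (n - α - (d₁ + β))) with hδ'
  have hδ'0 : 0 < δ' := lt_min (lt_min hd₀ hη0) (lt_min hd₀' hd₁β')
  obtain ⟨C₂, hC₂, hT₂⟩ := hB.weighted_kernelIntegral_le hn (β₀ := 0) (β₁ := β - η) hδ'0 hum hu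
    (by rw [add_zero]; exact (min_le_left _ _).trans (min_le_left _ _))
    (by rw [show d₁ + (β - η) = η by rw [hη]; ring]
        exact (min_le_left _ _).trans (min_le_right _ _))
    (by rw [add_zero]; exact (min_le_right _ _).trans (min_le_left _ _))
    (((min_le_right _ _).trans (min_le_right _ _)).trans (by linarith))
  simp only [hconst] at hT₁
  have hfinite : ∀ f, MemHerz β m₁ u f → ∀ l, kernelIntegral α b f l ≠ ∞ := by
    intro f hf l htop
    have h := hT₁ f hf.1 l
    -- An infinite kernel integral would make the weighted left side infinite, while the right side
    -- is at most a geometric sum times the Herz norm of `f`.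
    rw [htop, ENNReal.mul_top (p_rpow_ne_zero _), ENNReal.mul_top (p_rpow_ne_zero _),
      top_le_iff] at h
    refine ENNReal.mul_ne_top hC₁ ?_ h
    refine ne_top_of_le_ne_top ?_ (ENNReal.tsum_le_tsum fun k =>
      mul_le_mul_right (le_herzNorm hm₁ u f k) _)
    rw [ENNReal.tsum_mul_right, tsum_geometric_sub]
    exact ENNReal.mul_ne_top (tsum_geometric_int_ne_top (half_pos hδ0)) hf.2.ne
  obtain ⟨C₃, hC₃, hherz⟩ := herzNorm_le_of_geometric (p := p) (n := n) (β := β) (half_pos hδ0)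
    hm₁ hm (ENNReal.mul_ne_top (ENNReal.ofReal_ne_top (r := 2 * C)) hC₁) u v
  refine ⟨hfinite, C₃.toNNReal, fun f hf g hgm hg => ?_⟩
  have hS : ∀ l, lpNorm v ((sphereS p n l).indicator g) ≤ ENNReal.ofReal (2 * C) *
      ((p : ℝ≥0∞) ^ (l * signSeq d₀ d₁ l) * kernelIntegral α b f l) := fun l =>
    hB.lpNorm_sphereS_le hvm (hv.mono fun x hx => hx.1) (hfinite f hf l) (hg l)
  have hweight : ∀ (c : ℝ) (l : ℤ), (p : ℝ≥0∞) ^ c * lpNorm v ((sphereS p n l).indicator g) ≤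
      ENNReal.ofReal (2 * C) * ((p : ℝ≥0∞) ^ c *
        ((p : ℝ≥0∞) ^ (l * signSeq d₀ d₁ l) * kernelIntegral α b f l)) := fun c l =>
    (mul_le_mul_right (hS l) _).trans (le_of_eq (by ring))
  have hnorm : herzNorm β m₂ v g ≤ C₃ * herzNorm β m₁ u f := hherz f g fun l => by
    rw [mul_assoc]
    exact (hweight _ l).trans (mul_le_mul_right (hT₁ f hf.1 l) _)
  rw [ENNReal.coe_toNNReal hC₃]
  refine ⟨⟨?_, hnorm.trans_lt (ENNReal.mul_ne_top hC₃ hf.2.ne).lt_top⟩, hnorm⟩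
  refine memLpVarLoc_of_geometric hn (half_pos hδ'0) hη0 hw hN
    (hu.mono fun x hx => zero_lt_one.trans hx) hv huvw hf.1 hf.2.ne
    (ENNReal.mul_ne_top (ENNReal.ofReal_ne_top (r := 2 * C)) hC₂) (le_herzNorm hm₁ u f) hgm
    (fun l => (hS l).trans_lt (ENNReal.mul_ne_top ENNReal.ofReal_ne_top
      (ENNReal.mul_ne_top (p_rpow_ne_top _) (hfinite f hf l))).lt_top) fun l => ?_
  rw [mul_assoc]
  exact (hweight _ l).trans (mul_le_mul_right (hT₂ f hf.1 l) _)

end PadicHerz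

end

/-! ### The theorem: admissible slopes from the hypotheses on the exponents -/

open PadicHerz in
theorem theorem3p3 (p : ℕ) [Fact p.Prime] (n : ℕ) (m₁ m₂ α β : ℝ)
    (u v b : Qpn p n → ℝ)
    (hm₁ : 0 < m₁) (hm : m₁ ≤ m₂)
    (hu : IsVarExponent u) (hv : MemW0Infty v)
    (huv : ∀ x, 1 / v x = 1 / u x - α / n)
    (hα₀ : 0 < α) (hα : α < min (n / expSup u) (n / expSup (conjExp v)))
    (hβ₀ : -(n / expSup v) < β) (hβ : β < n / Real.conjExponent (expInf u))
    (hb₁ : MemCMO (conjExp u) b) (hb₂ : MemCMO v b) :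
    (∃ C : NNReal, ∀ f : Qpn p n → ℝ, MemHerz β m₁ u f →
      HardyDefined f ∧ HardyDefined (fun t => b t * f t) ∧
      MemHerz β m₂ v (hardyComm α b f) ∧
      herzNorm β m₂ v (hardyComm α b f) ≤ C * herzNorm β m₁ u f) ∧
    (∃ C : NNReal, ∀ f : Qpn p n → ℝ, MemHerz β m₁ u f →
      HardyAdjDefined α f ∧ HardyAdjDefined α (fun t => b t * f t) ∧
      MemHerz β m₂ v (hardyAdjComm α b f) ∧
      herzNorm β m₂ v (hardyAdjComm α b f) ≤ C * herzNorm β m₁ u f) := by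
  have hn : n ≠ 0 := by
    -- For `n = 0` both quotients in the bound on `α` are `0`.
    rintro rfl
    simp at hα
    linarith
  have hn0 : (0 : ℝ) < n := by positivity
  have hαn : 0 < α / n := by positivity
  have hve : IsVarExponent v := hv.1.1
  have hne : (ae (haar p n)).NeBot := ae_neBot.2 fun h =>
    haar_ballB_ne_zero (p := p) (n := n) 0 (by rw [h]; rfl)
  -- pointwise facts
  have hv_inv : ∀ x, 1 / v x ≤ 1 - α / n := fun x => by
    have : 1 / u x ≤ 1 := by
      rw [one_div]; exact inv_le_one_of_one_le₀ (hu.one_le x)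
    rw [huv x]; linarith
  have hv1 : ∀ x, 1 < v x := fun x => by
    have h1 := hve.one_le x
    refine lt_of_le_of_ne h1 fun h => ?_
    have := hv_inv x
    rw [← h] at this
    linarith
  have hconjv : ∀ x, conjExp v x ≤ n / α := fun x => by
    have h := hv_inv x
    have h1 := hv1 x
    rw [conjExp, Real.conjExponent, div_le_div_iff₀ (by linarith) hα₀]
    rw [div_le_iff₀ (by linarith), sub_mul, div_mul_eq_mul_div, one_mul] at h
    have h2 : α * v x / n ≤ v x - 1 := by linarith
    rw [div_le_iff₀ hn0] at h2
    linarith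
  -- essential bounds
  have bdd_above : ∀ {g : Qpn p n → ℝ} {c : ℝ}, (∀ᵐ x ∂haar p n, g x ≤ c) →
      ∀ᵐ x ∂haar p n, g x ≤ expSup g := fun h => ae_le_essSup ⟨_, eventually_map.2 h⟩
  have hvhi : ∀ᵐ x ∂haar p n, v x ≤ expSup v := bdd_above hve.ess_bdd.choose_spec
  have hSv : ∀ᵐ x ∂haar p n, conjExp v x ≤ expSup (conjExp v) :=
    bdd_above (Eventually.of_forall hconjv)
  have huinf : ∀ᵐ x ∂haar p n, expInf u ≤ u x :=
    ae_essInf_le ⟨1, eventually_map.2 (Eventually.of_forall hu.one_le)⟩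
  set S := expSup (conjExp v)
  have hS1 : 1 < S := by
    obtain ⟨x, hx⟩ := hSv.exists
    exact (Real.HolderConjugate.conjExponent (hv1 x)).symm.lt.trans_le hx
  have hαS : α / n < 1 / S := by
    have := hα.trans_le (min_le_right _ _)
    rw [lt_div_iff₀ (by linarith)] at this
    rw [div_lt_div_iff₀ hn0 (by linarith)]
    linarith
  -- Here `α < n/(v')₊` enters: `1/u = 1 - 1/v' + α/n ≤ 1 - (1/S - α/n) < 1`, so `u` stays away from
  -- `1`.
  obtain ⟨c, hc1, hcu⟩ : ∃ c : ℝ, 1 < c ∧ ∀ᵐ x ∂haar p n, c ≤ u x := by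
    have hpos : 0 < 1 - (1 / S - α / n) := by
      have : 1 / S < 1 := by rw [one_div]; exact inv_lt_one_of_one_lt₀ hS1
      linarith
    refine ⟨1 / (1 - (1 / S - α / n)), (one_lt_div hpos).2 (by linarith), ?_⟩
    filter_upwards [hSv] with x hx
    have hconj : (v x).HolderConjugate (conjExp v x) := Real.HolderConjugate.conjExponent (hv1 x)
    have h1 : 1 / S ≤ 1 / conjExp v x := one_div_le_one_div_of_le hconj.symm.pos hx
    rw [one_div (conjExp v x), ← hconj.one_sub_inv] at h1
    have h2 := huv x
    rw [one_div_le hpos (by linarith [hu.one_le x])]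
    rw [one_div (v x)] at h2
    linarith
  have hcInf : c ≤ expInf u := by
    obtain ⟨M, hM⟩ := hu.ess_bdd
    refine le_liminf_of_le (IsBoundedUnder.isCoboundedUnder_ge ⟨M, eventually_map.2 hM⟩) hcu
  set U := expInf u
  have hU1 : 1 < U := hc1.trans_le hcInf
  have hu1 : ∀ᵐ x ∂haar p n, 1 < u x := huinf.mono fun x hx => hU1.trans_le hx
  have hinvU : ∀ᵐ x ∂haar p n, 1 / v x ≤ 1 / U - α / n := by
    filter_upwards [huinf] with x hx
    rw [huv x]
    have := one_div_le_one_div_of_le (by linarith) hx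
    linarith
  have hκ0 : 0 < 1 / U - α / n := by
    obtain ⟨x, hx⟩ := hinvU.exists
    exact (one_div_pos.2 (zero_lt_one.trans (hv1 x))).trans_le hx
  have hκ1 : 1 / U - α / n ≤ 1 := by
    have : 1 / U < 1 := by rw [one_div]; exact inv_lt_one_of_one_lt₀ hU1
    linarith
  have hvlo : ∀ᵐ x ∂haar p n, 1 / (1 / U - α / n) ≤ v x := by
    filter_upwards [hinvU] with x hx
    exact (one_div_le hκ0 (zero_lt_one.trans (hv1 x))).2 hx
  have hMu : ∀ᵐ x ∂haar p n, conjExp u x ≤ U / (U - 1) := by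
    filter_upwards [huinf] with x hx
    rw [conjExp, Real.conjExponent, div_le_div_iff₀ (by linarith) (by linarith)]
    linarith
  -- limits of the exponent at the origin and at infinity
  obtain ⟨V₀, hV₀, V₁, hV₁, K, hK⟩ := exists_sphere_limits hn hv
    (hvlo.and hvhi : ∀ᵐ x ∂haar p n, v x ∈ Set.Icc (1 / (1 / U - α / n)) (expSup v))
  have hlo1 : 1 ≤ 1 / (1 / U - α / n) := (one_le_div hκ0).2 hκ1
  -- From `1/V ≤ 1/u₋ - α/n` follows `n - α - n/V ≥ n - n/u₋ = n/(u₋)'`, which is positive and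
  -- exceeds `β`; from `V ≤ v₊` follows `n/V + β > 0`.
  have bounds : ∀ V ∈ Set.Icc (1 / (1 / U - α / n)) (expSup v), 1 ≤ V ∧ 0 < n / V ∧
      0 < n - α - n / V ∧ 0 < n / V + β ∧ 0 < n - α - (n / V + β) := by
    rintro V ⟨hVl, hVh⟩
    have hV1 : 1 ≤ V := hlo1.trans hVl
    have h1 : n / expSup v ≤ n / V := div_le_div_of_nonneg_left hn0.le (by linarith) hVh
    have h2 : 1 / V ≤ 1 / U - α / n := (one_div_le (by linarith) hκ0).2 hVl
    have h3 : n / V ≤ n / U - α := by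
      calc (n : ℝ) / V = n * (1 / V) := by ring
        _ ≤ n * (1 / U - α / n) := mul_le_mul_of_nonneg_left h2 hn0.le
        _ = n / U - α := by field_simp
    have h4 : n / U < n := div_lt_self hn0 hU1
    have h5 : n / Real.conjExponent U = n - n / U := by
      have : U - 1 ≠ 0 := by linarith
      rw [Real.conjExponent]; field_simp
    rw [h5] at hβ
    exact ⟨hV1, by positivity, by linarith, by linarith, by linarith⟩
  obtain ⟨hV₀1, hd₀, hd₀', hd₀β, hd₀β'⟩ := bounds V₀ hV₀
  obtain ⟨hV₁1, hd₁, hd₁', hd₁β, hd₁β'⟩ := bounds V₁ hV₁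
  obtain ⟨C, hB⟩ := exists_ballBounds hn hve.measurable hu1 (Eventually.of_forall hv1) huv hMu hSv
    hV₀1 hV₁1 hα₀ hd₀' hd₁' hK hb₁ hb₂
  obtain ⟨w, N, hw, hN, hsep⟩ := exists_separating_exponent hn hα₀ hu.one_le hve.one_le huv hV₀1 hK
  obtain ⟨hT, C', hC'⟩ := exists_herz_bound hn hm₁ hm hu.measurable hve.measurable hu1
    (hvhi.mono fun x hx => ⟨hve.one_le x, hx⟩) hB hd₀ hd₀' hd₀β hd₁β hd₀β' hd₁β' hw hN hsep
  have hbm := hB.aemeasurable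
  refine ⟨⟨C', fun f hf => ?_⟩, ⟨C', fun f hf => ?_⟩⟩
  · have hfm := hf.1.aemeasurable
    refine ⟨fun x hx => ?_, fun x hx => ?_, hC' f hf _ (aemeasurable_hardyComm hn hbm)
      fun l x hx => (hardy_bounds hbm hfm (hT f hf l) hx).2.2⟩
    · obtain ⟨l, hl⟩ := exists_mem_sphereS hx
      exact (hardy_bounds hbm hfm (hT f hf l) hl).1
    · obtain ⟨l, hl⟩ := exists_mem_sphereS hx
      exact (hardy_bounds hbm hfm (hT f hf l) hl).2.1
  · have hfm := hf.1.aemeasurable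
    refine ⟨fun x hx => ?_, fun x hx => ?_, hC' f hf _ (aemeasurable_hardyAdjComm hn hbm)
      fun l x hx => (hardyAdj_bounds hbm hfm (hT f hf l) hx).2.2⟩
    · obtain ⟨l, hl⟩ := exists_mem_sphereS hx
      exact (hardyAdj_bounds hbm hfm (hT f hf l) hl).1
    · obtain ⟨l, hl⟩ := exists_mem_sphereS hx
      exact (hardyAdj_bounds hbm hfm (hT f hf l) hl).2.1
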